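/- Let $\mathrm{Homeo}^+(\mathbf R)$ be the group of orientation preserving homeomorphisms of the real line, and let $\mu$ be a finitely supported probability measure on $\mathrm{Homeo}^+(\mathbf R)$ that is symmetric, i.e. $\mu(g)=\mu(g^{-1})$ for all $g$. Let $G$ be the group generated by the support of $\mu$. Assume that $G$ is irreducible (no point of $\mathbf R$ is fixed by all of $G$) and that no orbit of $G$ is discrete (i.e. a closed discrete subset of $\mathbf R$). Then $G$ is semi-conjugate to a group with the Derriennic property, by the distribution function of a stationary Radon measure. Precisely: (i) there is a non-zero stationary Radon measure $\nu$ on $\mathbf R$, that is, $\nu=\sum_{g}\mu(g)\,g_*\nu$; (ii) for every non-zero stationary Radon measure $\nu$ and every $x_0\in\mathbf R$, put $D(x)=\nu[x_0,x]$ if $x\ge x_0$ and $D(x)=-\nu[x,x_0]$ if $x<x_0$. Then $D:\mathbf R\to\mathbf R$ is continuous, non-decreasing and surjective, and there is a homomorphism $g\mapsto\bar g$ from $G$ onto a subgroup $\overline G$ of $\mathrm{Homeo}^+(\mathbf R)$ such that $D(g(x))=\bar g(D(x))$ for all $g\in G$ and $x\in\mathbf R$, and such that, for every $x\in\mathbf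 R$, $$x=\int_{\overline G}\bar g(x)\,d\mu(\bar g),$$ where $\mu$ on $\overline G$ denotes the image of $\mu$ under $g\mapsto\bar g$. -/

import Mathlib

open MeasureTheory Set

noncomputable section

/-- The group `Homeo⁺(ℝ)` of orientation preserving homeomorphisms of the real line
(the product is composition). -/
def homeoPlus : Subgroup (ℝ ≃ₜ ℝ) where
  carrier := {g | StrictMono g}
  one_mem' := strictMono_id
  mul_mem' := fun {g h} (hg : StrictMono g) (hh : StrictMono h) => hg.comp hh
  inv_mem' := by
    intro g hg x y hxy
    have h : g (g⁻¹ x) < g (g⁻¹ y) := by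
      have e : ∀ z, g (g⁻¹ z) = z := fun z => g.apply_symm_apply z
      rwa [e, e]
    exact hg.lt_iff_lt.mp h

abbrev HomeoPlus : Type := ↥homeoPlus

instance : CoeFun HomeoPlus (fun _ => ℝ → ℝ) := ⟨fun g => (g : ℝ ≃ₜ ℝ)⟩

/-- The action of `G` on the line is irreducible: there is no global fixed point. -/
def IsIrreducibleAction (G : Subgroup HomeoPlus) : Prop :=
  ∀ x : ℝ, ∃ g ∈ G, g x ≠ x

/-- The orbit of `x` under `G`. -/
def lineOrbit (G : Subgroup HomeoPlus) (x : ℝ) : Set ℝ :=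
  {y | ∃ g ∈ G, g x = y}

/-- The orbit of `x` is discrete, i.e. a closed discrete (equivalently, locally finite)
subset of the line. -/
def IsDiscreteOrbit (G : Subgroup HomeoPlus) (x : ℝ) : Prop :=
  IsClosed (lineOrbit G x) ∧ DiscreteTopology (lineOrbit G x)

/-- The group generated by the support of a discrete probability measure on `Homeo⁺(ℝ)`. -/
def generatedGroup (μ : PMF HomeoPlus) : Subgroup HomeoPlus :=
  Subgroup.closure μ.support

/-- `μ`, seen as a probability measure on the group generated by its support. -/
def onGeneratedGroup (μ : PMF HomeoPlus) : PMF (generatedGroup μ) :=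
  ⟨fun g => μ (g : HomeoPlus), by
    have h : Function.support (fun g => μ g) ⊆ (generatedGroup μ : Set HomeoPlus) :=
      Subgroup.subset_closure
    exact (hasSum_subtype_iff_of_support_subset h).mpr μ.2⟩

/-- `μ` is symmetric: `g` and `g⁻¹` have the same mass. -/
def IsSymmetricPMF (μ : PMF HomeoPlus) : Prop :=
  ∀ g : HomeoPlus, μ g⁻¹ = μ g

/-- `ν` is stationary (`P`-invariant) for the random walk of law `μ`:
`∑ g, μ(g) g_* ν = ν`. -/
def IsStationaryMeasure (μ : PMF HomeoPlus) (ν : Measure ℝ) : Prop :=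
  Measure.sum (fun g : HomeoPlus => μ g • ν.map g) = ν

/-- A non-zero stationary Radon measure (on the real line, a Borel measure is Radon if and
only if it is locally finite). -/
structure IsStationaryRadon (μ : PMF HomeoPlus) (ν : Measure ℝ) : Prop where
  locallyFinite : IsLocallyFiniteMeasure ν
  ne_zero : ν ≠ 0
  stationary : IsStationaryMeasure μ ν

/-- The distribution function of `ν` based at `x₀`. -/
def distributionFunction (ν : Measure ℝ) (x₀ x : ℝ) : ℝ :=
  if x₀ ≤ x then ν.real (Icc x₀ x) else - ν.real (Icc x x₀)

/-- `D` is a semi-conjugacy from the action of `G` to the action of its homomorphic image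
`ρ.range`, with `g` corresponding to `ρ g`. -/
structure IsSemiconjugacy {G : Subgroup HomeoPlus} (ρ : G →* HomeoPlus) (D : ℝ → ℝ) : Prop where
  continuous : Continuous D
  monotone : Monotone D
  surjective : Function.Surjective D
  equivariant : ∀ (g : G) (x : ℝ), D ((g : HomeoPlus) x) = ρ g (D x)

/-- The pair `(H, m)` has the Derriennic property: `x = ∫ h(x) dm(h)` for every `x`. -/
def HasDerriennicProperty (H : Subgroup HomeoPlus) (m : PMF H) : Prop :=
  ∀ x : ℝ, HasSum (fun h : H => (m h).toReal * (h : HomeoPlus) x) x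

end

/-! ### Order calculus in the group of increasing homeomorphisms -/

namespace HomeoPlus

/-! Let P be the averaging operator of the walk.

Existence of a stationary measure: `exists_harmonic_on` solves a Dirichlet problem on long
intervals, with value 0 on the left and 1 on the right. A Harnack inequality for increments
(`exists_harnack_const`) bounds the normalized solutions locally, so an ultralimit is a non-constant
monotone harmonic function. By symmetry of the weights, its Stieltjes measure is stationary.

Let ν be any non-zero stationary Radon measure, with distribution function F. Stationarity alone
gives PF = F + c for a constant c. To see that c = 0, record the jumps from x across y by an
antisymmetric kernel whose integral in y is c. Integrating over x in (a, b] shows that c ν(a, b] is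
the flux across b minus the flux across a (`drift_mul_eq`). Fluxes are non-negative and not all
zero, which makes F unbounded on both sides and then kills c (`drift_eq_zero`).

The function x ↦ ν{x} is harmonic too, and its truncations are superharmonic. A summation by parts
against cutoffs built from √|F| makes these truncations harmonic, so atoms have constant mass along
orbits (`measureReal_singleton_apply`). An orbit of atoms is locally finite, which is excluded;
hence ν has no atoms and F is a continuous surjection. Since G preserves ν-null intervals, the
action descends through F, and harmonicity of F becomes the Derriennic property. -/

theorem strictMono (g : HomeoPlus) : StrictMono (g : ℝ → ℝ) := g.2

theorem monotone (g : HomeoPlus) : Monotone (g : ℝ → ℝ) := g.strictMono.monotone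

theorem continuous (g : HomeoPlus) : Continuous (g : ℝ → ℝ) := (g : ℝ ≃ₜ ℝ).continuous

theorem mul_apply (g h : HomeoPlus) (x : ℝ) : (g * h) x = g (h x) := rfl

theorem inv_apply_self (g : HomeoPlus) (x : ℝ) : g⁻¹ (g x) = x :=
  (g : ℝ ≃ₜ ℝ).symm_apply_apply x

theorem apply_inv_self (g : HomeoPlus) (x : ℝ) : g (g⁻¹ x) = x :=
  (g : ℝ ≃ₜ ℝ).apply_symm_apply x

theorem lt_inv_apply (g : HomeoPlus) {x y : ℝ} : x < g⁻¹ y ↔ g x < y := by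
  rw [← g.strictMono.lt_iff_lt, apply_inv_self]

theorem le_inv_apply (g : HomeoPlus) {x y : ℝ} : x ≤ g⁻¹ y ↔ g x ≤ y := by
  rw [← g.strictMono.le_iff_le, apply_inv_self]

theorem inv_apply_lt (g : HomeoPlus) {x y : ℝ} : g⁻¹ x < y ↔ x < g y := by
  rw [← g.strictMono.lt_iff_lt, apply_inv_self]

theorem inv_apply_le (g : HomeoPlus) {x y : ℝ} : g⁻¹ x ≤ y ↔ x ≤ g y := by
  rw [← g.strictMono.le_iff_le, apply_inv_self]

theorem preimage_Ioc (g : HomeoPlus) (a b : ℝ) :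
    (g : ℝ → ℝ) ⁻¹' Ioc a b = Ioc (g⁻¹ a) (g⁻¹ b) := by
  ext x
  simp only [mem_preimage, mem_Ioc, inv_apply_lt, le_inv_apply]

end HomeoPlus

/-! ### Monotone harmonic functions of a symmetric walk -/

theorem exists_fixed_point_of_monotone {α : Type*} [CompleteLattice α] (f : α → α)
    (hf : Monotone f) : ∃ x, f x = x :=
  ⟨OrderHom.lfp ⟨f, hf⟩, OrderHom.map_lfp ⟨f, hf⟩⟩

/-- A finite symmetric system of weights on `Homeo⁺(ℝ)` whose support moves every point. -/
structure IsSymmetricWalk (S : Finset HomeoPlus) (w : HomeoPlus → ℝ) : Prop where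
  pos : ∀ s ∈ S, 0 < w s
  sum_eq_one : ∑ s ∈ S, w s = 1
  inv_mem : ∀ s ∈ S, s⁻¹ ∈ S
  inv_weight : ∀ s ∈ S, w s⁻¹ = w s
  exists_lt : ∀ x : ℝ, ∃ s ∈ S, x < s x

/-- The function `f` is harmonic at `x` for the walk with weights `w`. -/
def IsHarmonicAt (S : Finset HomeoPlus) (w : HomeoPlus → ℝ) (f : ℝ → ℝ) (x : ℝ) : Prop :=
  ∑ s ∈ S, w s * f (s x) = f x

namespace IsSymmetricWalk

variable {S : Finset HomeoPlus} {w : HomeoPlus → ℝ} (h : IsSymmetricWalk S w)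
include h

theorem exists_gt (x : ℝ) : ∃ s ∈ S, s x < x := by
  obtain ⟨s, hs, hx⟩ := h.exists_lt x
  exact ⟨s⁻¹, h.inv_mem s hs, s.inv_apply_lt.2 hx⟩

theorem nonempty : S.Nonempty := (h.exists_lt 0).imp fun _ hs => hs.1

theorem sum_inv {M : Type*} [AddCommMonoid M] (F : HomeoPlus → M) :
    ∑ s ∈ S, F s⁻¹ = ∑ s ∈ S, F s :=
  Finset.sum_bij (fun s _ => s⁻¹) h.inv_mem (fun _ _ _ _ => inv_inj.1)
    (fun s hs => ⟨s⁻¹, h.inv_mem s hs, inv_inv s⟩) (fun _ _ => rfl)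

theorem sum_weight_mul_inv (F : HomeoPlus → ℝ) :
    ∑ s ∈ S, w s * F s⁻¹ = ∑ s ∈ S, w s * F s := by
  rw [← h.sum_inv fun s => w s * F s]
  exact Finset.sum_congr rfl fun s hs => by rw [h.inv_weight s hs]

theorem sum_weight_mul_const (c : ℝ) : ∑ s ∈ S, w s * c = c := by
  rw [← Finset.sum_mul, h.sum_eq_one, one_mul]

theorem exists_sup : ∃ M : ℝ → ℝ, (∀ x, ∃ s ∈ S, M x = s x) ∧ ∀ x, ∀ s ∈ S, s x ≤ M x := by
  choose σ hσ hmax using fun x : ℝ => S.exists_max_image (fun s => s x) h.nonempty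
  exact ⟨fun x => σ x x, fun x => ⟨σ x, hσ x, rfl⟩, hmax⟩

theorem exists_inf : ∃ m : ℝ → ℝ, (∀ x, ∃ s ∈ S, m x = s x) ∧ ∀ x, ∀ s ∈ S, m x ≤ s x := by
  choose σ hσ hmin using fun x : ℝ => S.exists_min_image (fun s => s x) h.nonempty
  exact ⟨fun x => σ x x, fun x => ⟨σ x, hσ x, rfl⟩, hmin⟩

/-- Functions which are harmonic on an interval and equal to the indicator of the right half
line outside it. -/
theorem exists_harmonic_on {a b : ℝ} (hab : a ≤ b) :
    ∃ f : ℝ → ℝ, Monotone f ∧ (∀ x < a, f x = 0) ∧ (∀ x > b, f x = 1) ∧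
      ∀ x ∈ Icc a b, IsHarmonicAt S w f x := by
  have mem : ∀ (f : ℝ →o unitInterval) (x : ℝ),
      ∑ s ∈ S, w s * (f (s x) : ℝ) ∈ unitInterval := fun f x =>
    ⟨Finset.sum_nonneg fun s hs => mul_nonneg (h.pos s hs).le (f _).2.1,
      h.sum_eq_one ▸ Finset.sum_le_sum fun s hs =>
        mul_le_of_le_one_right (h.pos s hs).le (f _).2.2⟩
  -- Averaging on [a, b] with the outer values reset to 0 and 1 is a monotone operator on the
  -- complete lattice of monotone maps to [0, 1]. Knaster–Tarski then gives a fixed point without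
  -- any continuity.
  let T : (ℝ →o unitInterval) →o (ℝ →o unitInterval) :=
    { toFun := fun f =>
        { toFun := fun x => if x < a then 0 else if b < x then 1 else ⟨_, mem f x⟩
          monotone' := by
            intro x y hxy
            dsimp only
            split_ifs with h1 h2 h3 h4 h5 h6 h7
            all_goals first
              | exact le_rfl | exact unitInterval.nonneg' | exact unitInterval.le_one'
              | (exfalso; linarith) | skip
            exact Subtype.mk_le_mk.2 (Finset.sum_le_sum fun s hs =>
              mul_le_mul_of_nonneg_left (f.monotone (s.monotone hxy)) (h.pos s hs).le) }
      monotone' := by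
        intro f g hfg x
        change (if x < a then (0 : unitInterval) else if b < x then 1 else ⟨_, mem f x⟩)
          ≤ (if x < a then (0 : unitInterval) else if b < x then 1 else ⟨_, mem g x⟩)
        split_ifs
        · exact le_rfl
        · exact le_rfl
        · exact Subtype.mk_le_mk.2 (Finset.sum_le_sum fun s hs =>
            mul_le_mul_of_nonneg_left (hfg (s x)) (h.pos s hs).le) }
  obtain ⟨φ, hφ⟩ : ∃ φ : ℝ →o unitInterval, T φ = φ := 
    exists_fixed_point_of_monotone (α := ℝ →o unitInterval) T fun f g hfg => T.monotone' hfg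
  have key : ∀ x, φ x =
      (if x < a then 0 else if b < x then 1 else ⟨_, mem φ x⟩ : unitInterval) :=
    fun x => (DFunLike.congr_fun hφ x).symm
  refine ⟨fun x => (φ x : ℝ), fun x y hxy =>
    φ.monotone hxy,
    fun x hx => ?_, fun x hx => ?_, fun x hx => ?_⟩
  · dsimp only
    rw [key x, if_pos hx]; rfl
  · dsimp only
    rw [key x, if_neg (by linarith), if_pos hx]; rfl
  · unfold IsHarmonicAt
    dsimp only
    conv_rhs => rw [key x, if_neg hx.1.not_gt, if_neg hx.2.not_gt]

/-- The increment f y - f x is the average of the non-negative increments f (s y) - f (s x), so each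
of them is at most (w s)⁻¹ times it. -/
theorem exists_harnack_const : ∃ C : ℝ, 0 ≤ C ∧ ∀ (f : ℝ → ℝ), Monotone f → ∀ x y, x ≤ y →
    IsHarmonicAt S w f x → IsHarmonicAt S w f y → ∀ s ∈ S, f (s y) - f (s x) ≤ C * (f y - f x) := by
  refine ⟨∑ s ∈ S, (w s)⁻¹, Finset.sum_nonneg fun s hs => (inv_pos.2 (h.pos s hs)).le,
    fun f hf x y hxy hx hy s hs => ?_⟩
  have h1 : w s * (f (s y) - f (s x)) ≤ f y - f x := by
    rw [← hx, ← hy, ← Finset.sum_sub_distrib]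
    simp only [← mul_sub]
    exact Finset.single_le_sum (f := fun s : HomeoPlus => w s * (f (s y) - f (s x)))
      (fun t ht => mul_nonneg (h.pos t ht).le (sub_nonneg.2 (hf (t.monotone hxy)))) hs
  have h2 : (w s)⁻¹ ≤ ∑ s ∈ S, (w s)⁻¹ :=
    Finset.single_le_sum (f := fun s => (w s)⁻¹) (fun t ht => (inv_pos.2 (h.pos t ht)).le) hs
  calc f (s y) - f (s x) = (w s)⁻¹ * (w s * (f (s y) - f (s x))) := by
        field_simp [(h.pos s hs).ne']
    _ ≤ (w s)⁻¹ * (f y - f x) := mul_le_mul_of_nonneg_left h1 (inv_pos.2 (h.pos s hs)).le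
    _ ≤ _ := mul_le_mul_of_nonneg_right h2 (sub_nonneg.2 (hf hxy))

/-- Otherwise the iterates increase to a finite supremum, which no element of `S` could move to the
right. -/
theorem exists_le_iterate_sup {M : ℝ → ℝ} (hM : ∀ x, ∀ s ∈ S, s x ≤ M x) (x₀ x : ℝ) :
    ∃ k, x ≤ M^[k] x₀ := by
  by_contra! hx
  have hmono : Monotone fun k => M^[k] x₀ := monotone_nat_of_le_succ fun k => by
    rw [Function.iterate_succ_apply']
    obtain ⟨s, hs, hlt⟩ := h.exists_lt (M^[k] x₀)
    exact hlt.le.trans (hM _ s hs)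
  have hb : BddAbove (range fun k => M^[k] x₀) := ⟨x, by rintro _ ⟨k, rfl⟩; exact (hx k).le⟩
  obtain ⟨s, hs, hlt⟩ := h.exists_lt (⨆ k, M^[k] x₀)
  refine hlt.not_ge (le_of_tendsto ((s.continuous.tendsto _).comp (tendsto_atTop_ciSup hmono hb))
    (Filter.Eventually.of_forall fun k => ?_))
  have := le_ciSup hb (k + 1)
  rw [Function.iterate_succ_apply'] at this
  exact (hM _ s hs).trans this

theorem exists_iterate_inf_le {m : ℝ → ℝ} (hm : ∀ x, ∀ s ∈ S, m x ≤ s x) (x₀ x : ℝ) :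
    ∃ k, m^[k] x₀ ≤ x := by
  by_contra! hx
  have hmono : Antitone fun k => m^[k] x₀ := antitone_nat_of_succ_le fun k => by
    rw [Function.iterate_succ_apply']
    obtain ⟨s, hs, hlt⟩ := h.exists_gt (m^[k] x₀)
    exact (hm _ s hs).trans hlt.le
  have hb : BddBelow (range fun k => m^[k] x₀) := ⟨x, by rintro _ ⟨k, rfl⟩; exact (hx k).le⟩
  obtain ⟨s, hs, hlt⟩ := h.exists_gt (⨅ k, m^[k] x₀)
  refine hlt.not_ge (ge_of_tendsto ((s.continuous.tendsto _).comp (tendsto_atTop_ciInf hmono hb))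
    (Filter.Eventually.of_forall fun k => ?_))
  have := ciInf_le hb (k + 1)
  rw [Function.iterate_succ_apply'] at this
  exact this.trans (hm _ s hs)

/-- There is a non-constant non-decreasing harmonic function on the line. -/
theorem exists_monotone_harmonic :
    ∃ D : ℝ → ℝ, Monotone D ∧ (∃ x y, D x < D y) ∧ ∀ x, IsHarmonicAt S w D x := by
  obtain ⟨M, hMs, hM⟩ := h.exists_sup
  obtain ⟨m, hms, hm⟩ := h.exists_inf
  obtain ⟨C, hC, harnack⟩ := h.exists_harnack_const
  have hlt : ∀ x, x < M x := fun x => let ⟨s, hs, hx⟩ := h.exists_lt x; hx.trans_le (hM x s hs)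
  have hgt : ∀ x, m x < x := fun x => let ⟨s, hs, hx⟩ := h.exists_gt x; (hm x s hs).trans_lt hx
  set p : ℕ → ℝ := fun k => M^[k] 0 with hp
  set q : ℕ → ℝ := fun k => m^[k] 0 with hq
  have p0 : p 0 = 0 := rfl
  have q0 : q 0 = 0 := rfl
  have psucc : ∀ k, p (k + 1) = M (p k) := fun k => Function.iterate_succ_apply' M k 0
  have qsucc : ∀ k, q (k + 1) = m (q k) := fun k => Function.iterate_succ_apply' m k 0
  have pmono : StrictMono p := strictMono_nat_of_lt_succ fun k => psucc k ▸ hlt _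
  have qanti : StrictAnti q := strictAnti_nat_of_succ_lt fun k => qsucc k ▸ hgt _
  have qp : ∀ k l, q k ≤ p l := fun k l =>
    (qanti.antitone (Nat.zero_le k)).trans (pmono.monotone (Nat.zero_le l))
  set B : ℕ → ℝ := fun k => ∑ j ∈ Finset.range k, C ^ j with hB
  -- The bounds `B k` do not depend on `n`; this is what makes a limit possible. They reach k = n +
  -- 1 because Harnack at indices up to `n` controls one further step.
  have approx : ∀ n, ∃ D : ℝ → ℝ, Monotone D ∧ D (p 1) - D (q 1) = 1 ∧
      (∀ x ∈ Icc (q n) (p n), IsHarmonicAt S w D x) ∧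
      ∀ k ≤ n + 1, D (p k) ≤ B k ∧ -B k ≤ D (q k) := by
    intro n
    obtain ⟨f, hf, hf0, hf1, hfh⟩ := h.exists_harmonic_on (qp n n)
    have hMf : ∀ x y, x ≤ y → x ∈ Icc (q n) (p n) → y ∈ Icc (q n) (p n) →
        f (M y) - f (M x) ≤ C * (f y - f x) := by
      intro x y hxy hx hy
      -- Choose `s` attaining the maximum at `y`: then M y = s y while M x ≥ s x, so the increment
      -- between the maxima is bounded by that of `s`.
      obtain ⟨s, hs, e⟩ := hMs y
      have := harnack f hf x y hxy (hfh x hx) (hfh y hy) s hs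
      have := hf (hM x s hs)
      rw [e]; linarith
    have hmf : ∀ x y, x ≤ y → x ∈ Icc (q n) (p n) → y ∈ Icc (q n) (p n) →
        f (m y) - f (m x) ≤ C * (f y - f x) := by
      intro x y hxy hx hy
      obtain ⟨s, hs, e⟩ := hms x
      have := harnack f hf x y hxy (hfh x hx) (hfh y hy) s hs
      have := hf (hm y s hs)
      rw [e]; linarith
    have pI : ∀ k ≤ n, p k ∈ Icc (q n) (p n) := fun k hk => ⟨qp _ _, pmono.monotone hk⟩
    have qI : ∀ k ≤ n, q k ∈ Icc (q n) (p n) := fun k hk => ⟨qanti.antitone hk, qp _ _⟩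
    set N := f (p 1) - f (q 1) with hN
    have hN1 : f (p 1) - f (p 0) ≤ N := by
      have := hf (qp 1 0); linarith
    have hN2 : f (q 0) - f (q 1) ≤ N := by
      have := hf (qp 0 1); linarith
    have ha : ∀ k ≤ n, f (p (k + 1)) - f (p k) ≤ C ^ k * N := by
      intro k
      induction k with
      | zero => intro _; simpa using hN1
      | succ k ih =>
        intro hk
        have h1 := hMf (p k) (p (k + 1)) (pmono.monotone k.le_succ) (pI k (by omega)) (pI _ hk)
        rw [← psucc, ← psucc] at h1
        refine h1.trans ?_
        rw [pow_succ', mul_assoc]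
        exact mul_le_mul_of_nonneg_left (ih (by omega)) hC
    have hb : ∀ k ≤ n, f (q k) - f (q (k + 1)) ≤ C ^ k * N := by
      intro k
      induction k with
      | zero => intro _; simpa using hN2
      | succ k ih =>
        intro hk
        have h1 := hmf (q (k + 1)) (q k) (qanti.antitone k.le_succ) (qI _ hk) (qI k (by omega))
        rw [← qsucc, ← qsucc] at h1
        refine h1.trans ?_
        rw [pow_succ', mul_assoc]
        exact mul_le_mul_of_nonneg_left (ih (by omega)) hC
    have hA : ∀ k ≤ n + 1, f (p k) - f 0 ≤ B k * N := by
      intro k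
      induction k with
      | zero => intro _; simp [p0, hB]
      | succ k ih =>
        intro hk
        have := ih (by omega)
        have := ha k (by omega)
        have e : B (k + 1) = B k + C ^ k := Finset.sum_range_succ _ _
        rw [e, add_mul]; linarith
    have hA' : ∀ k ≤ n + 1, f 0 - f (q k) ≤ B k * N := by
      intro k
      induction k with
      | zero => intro _; simp [q0, hB]
      | succ k ih =>
        intro hk
        have := ih (by omega)
        have := hb k (by omega)
        have e : B (k + 1) = B k + C ^ k := Finset.sum_range_succ _ _
        rw [e, add_mul]; linarith
    -- If `N` vanished, the increment bounds would give f (p (n + 1)) ≤ f 0 ≤ f (q (n + 1)). Both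
    -- points lie just outside the interval, where `f` is 1 and 0 respectively.
    have hNpos : 0 < N := by
      have hN0 : 0 ≤ N := sub_nonneg.2 (hf (qp 1 1))
      rcases hN0.eq_or_lt with e | e
      · have h1 := hA (n + 1) le_rfl
        have h2 := hA' (n + 1) le_rfl
        rw [hf1 _ (pmono n.lt_succ_self), ← e] at h1
        rw [hf0 _ (qanti n.lt_succ_self), ← e] at h2
        simp only [mul_zero] at h1 h2
        linarith
      · exact e
    refine ⟨fun x => (f x - f 0) / N, fun x y hxy => ?_, ?_, fun x hx => ?_, fun k hk => ⟨?_, ?_⟩⟩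
    · have := hf hxy
      dsimp only; gcongr
    · rw [← sub_div, sub_sub_sub_cancel_right, ← hN, div_self hNpos.ne']
    · unfold IsHarmonicAt
      dsimp only
      rw [← hfh x hx]
      simp only [mul_div_assoc', ← Finset.sum_div, mul_sub, Finset.sum_sub_distrib,
        h.sum_weight_mul_const]
    · rw [div_le_iff₀ hNpos]; exact hA k hk
    · rw [le_div_iff₀ hNpos]; linarith [hA' k hk]
  choose D Dmono Done Dharm Dbd using approx
  have loc : ∀ x, ∃ K, x ∈ Icc (q K) (p K) := by
    intro x
    obtain ⟨k, hk⟩ := h.exists_le_iterate_sup hM 0 x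
    obtain ⟨l, hl⟩ := h.exists_iterate_inf_le hm 0 x
    exact ⟨max k l, (qanti.antitone (le_max_right k l)).trans hl,
      hk.trans (pmono.monotone (le_max_left k l))⟩
  -- A non-principal ultrafilter gives limits at all real points simultaneously, without extracting
  -- subsequences.
  have evt : ∀ K, ∀ᶠ n in (Filter.hyperfilter ℕ : Filter ℕ), K ≤ n := fun K =>
    Nat.hyperfilter_le_atTop (Filter.eventually_ge_atTop K)
  have lim : ∀ x, ∃ l, Filter.Tendsto (fun n => D n x) (Filter.hyperfilter ℕ : Filter ℕ) (nhds l) := by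
    intro x
    obtain ⟨K, hK⟩ := loc x
    obtain ⟨l, -, hl⟩ := (isCompact_Icc (a := -B K) (b := B K)).ultrafilter_le_nhds
      ((Filter.hyperfilter ℕ).map fun n => D n x) (by
        rw [Filter.le_principal_iff, Ultrafilter.mem_coe, Ultrafilter.mem_map,
          ← Ultrafilter.mem_coe]
        filter_upwards [evt K] with n hn
        exact ⟨(Dbd n K (by omega)).2.trans (Dmono n hK.1),
          (Dmono n hK.2).trans (Dbd n K (by omega)).1⟩)
    exact ⟨l, hl⟩
  choose L hL using lim
  refine ⟨L, fun x y hxy => le_of_tendsto_of_tendsto' (hL x) (hL y) fun n => Dmono n hxy,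
    ⟨q 1, p 1, ?_⟩, fun x => ?_⟩
  · have : L (p 1) - L (q 1) = 1 :=
      tendsto_nhds_unique ((hL (p 1)).sub (hL (q 1))) (by simp only [Done]; exact tendsto_const_nhds)
    linarith
  · obtain ⟨K, hK⟩ := loc x
    refine tendsto_nhds_unique (tendsto_finsetSum S fun s _ => (hL (s x)).const_mul (w s))
      ((hL x).congr' ?_)
    filter_upwards [evt K] with n hn
    exact (Dharm n x ⟨(qanti.antitone hn).trans hK.1, hK.2.trans (pmono.monotone hn)⟩).symm

end IsSymmetricWalk

/-! ### Stationary measures: translation to finite sums, and existence -/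

/-- Stationarity of a measure under a finite system of weights. -/
def IsWalkStationary (S : Finset HomeoPlus) (w : HomeoPlus → ℝ) (ν : Measure ℝ) : Prop :=
  ∀ A, MeasurableSet A → ν A = ∑ s ∈ S, ENNReal.ofReal (w s) * ν ((s : ℝ → ℝ) ⁻¹' A)

theorem isSymmetricWalk_of_pmf (μ : PMF HomeoPlus) (hfin : μ.support.Finite)
    (hsymm : IsSymmetricPMF μ) (hirr : IsIrreducibleAction (generatedGroup μ)) :
    IsSymmetricWalk hfin.toFinset fun g => (μ g).toReal := by
  have hinv : ∀ s ∈ hfin.toFinset, s⁻¹ ∈ hfin.toFinset := fun s hs => by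
    simpa [PMF.mem_support_iff, hsymm s] using hs
  refine ⟨fun s hs => ?_, ?_, hinv, fun s _ => by rw [hsymm s], fun x => ?_⟩
  · exact ENNReal.toReal_pos (by simpa using hs) (μ.apply_ne_top s)
  · have e : ∑ s ∈ hfin.toFinset, μ s = 1 := by
      rw [← μ.tsum_coe]
      exact (tsum_eq_sum fun s hs => by simpa using hs).symm
    rw [← ENNReal.toReal_sum fun s _ => μ.apply_ne_top s, e, ENNReal.toReal_one]
  · by_contra! hx
    -- If no element of the support moves `x` to the right, then by symmetry none moves it to the
    -- left.
    have hfix : ∀ s ∈ μ.support, s x = x := fun s hs => by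
      have hs' : s ∈ hfin.toFinset := by simpa using hs
      exact le_antisymm (hx s hs') (s.inv_apply_le.1 (hx _ (hinv s hs')))
    obtain ⟨g, hg, hne⟩ := hirr x
    refine hne (Subgroup.closure_induction (p := fun g _ => g x = x) hfix rfl
      (fun a b _ _ ha hb => ?_) (fun a _ ha => ?_) hg)
    · rw [HomeoPlus.mul_apply, hb, ha]
    · conv_lhs => rw [← ha]
      exact a.inv_apply_self x

theorem isStationaryMeasure_iff (μ : PMF HomeoPlus) (hfin : μ.support.Finite) (ν : Measure ℝ) :
    IsStationaryMeasure μ ν ↔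
      IsWalkStationary hfin.toFinset (fun g => (μ g).toReal) ν := by
  have key : ∀ A, MeasurableSet A → Measure.sum (fun g : HomeoPlus => μ g • ν.map g) A =
      ∑ s ∈ hfin.toFinset, ENNReal.ofReal (μ s).toReal * ν ((s : ℝ → ℝ) ⁻¹' A) := by
    intro A hA
    rw [Measure.sum_apply _ hA, tsum_eq_sum (s := hfin.toFinset)]
    · refine Finset.sum_congr rfl fun s _ => ?_
      rw [Measure.smul_apply, Measure.map_apply s.continuous.measurable hA, smul_eq_mul,
        ENNReal.ofReal_toReal (μ.apply_ne_top s)]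
    · intro s hs
      have : μ s = 0 := by simpa using hs
      simp [this]
  exact ⟨fun h A hA => by rw [← key A hA, h], fun h => Measure.ext fun A hA => by
    rw [key A hA, ← h A hA]⟩

namespace IsSymmetricWalk

variable {S : Finset HomeoPlus} {w : HomeoPlus → ℝ} (h : IsSymmetricWalk S w)
include h

theorem exists_stationary : ∃ ν : Measure ℝ,
    IsLocallyFiniteMeasure ν ∧ ν ≠ 0 ∧ IsWalkStationary S w ν := by
  obtain ⟨D, hD, ⟨x, y, hxy⟩, hharm⟩ := h.exists_monotone_harmonic
  -- The right-continuous modification stays harmonic, because every `s` maps right neighbourhoods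
  -- of x to right neighbourhoods of s x.
  set F := hD.stieltjesFunction with hF
  have hFharm : ∀ x, IsHarmonicAt S w F x := by
    intro x
    unfold IsHarmonicAt
    have hlim : ∀ z, Filter.Tendsto D (nhdsWithin z (Ioi z)) (nhds (F z)) := fun z => by
      rw [hF, hD.stieltjesFunction_eq]; exact hD.tendsto_rightLim z
    have hs : ∀ s : HomeoPlus, Filter.Tendsto (s : ℝ → ℝ) (nhdsWithin x (Ioi x))
        (nhdsWithin (s x) (Ioi (s x))) := fun s =>
      tendsto_nhdsWithin_iff.2 ⟨s.continuous.continuousWithinAt,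
        eventually_nhdsWithin_of_forall fun y hy => s.strictMono hy⟩
    exact tendsto_nhds_unique (tendsto_finsetSum S fun s _ =>
      ((hlim (s x)).comp (hs s)).const_mul (w s)) ((hlim x).congr fun y => (hharm y).symm)
  refine ⟨F.measure, inferInstance, fun h0 => ?_, ?_⟩
  -- The window starts at x - 1 because F x, a right limit, may already exceed D x.
  · have h1 : F.measure (Ioc (x - 1) y) = 0 := by rw [h0]; rfl
    rw [F.measure_Ioc, ENNReal.ofReal_eq_zero] at h1
    have h2 : D y ≤ F y := by rw [hF, hD.stieltjesFunction_eq]; exact hD.le_rightLim le_rfl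
    have h3 : F (x - 1) ≤ D x := by
      rw [hF, hD.stieltjesFunction_eq]; exact hD.rightLim_le (by linarith)
    linarith
  · have e : F.measure = ∑ s ∈ S, ENNReal.ofReal (w s) • F.measure.map s := by
      refine Measure.ext_of_Ioc _ _ fun a b hab => ?_
      rw [Measure.finsetSum_apply]
      simp only [Measure.smul_apply, smul_eq_mul]
      have : ∀ s ∈ S, ENNReal.ofReal (w s) * F.measure.map s (Ioc a b) =
          ENNReal.ofReal (w s * (F (s⁻¹ b) - F (s⁻¹ a))) := fun s hs => by
        rw [Measure.map_apply s.continuous.measurable measurableSet_Ioc, s.preimage_Ioc,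
          F.measure_Ioc, ENNReal.ofReal_mul (h.pos s hs).le]
      rw [Finset.sum_congr rfl this, F.measure_Ioc, ← ENNReal.ofReal_sum_of_nonneg]
      · rw [h.sum_weight_mul_inv fun s => F (s b) - F (s a)]
        simp only [mul_sub, Finset.sum_sub_distrib]
        rw [hFharm, hFharm]
      · exact fun s hs => mul_nonneg (h.pos s hs).le
          (sub_nonneg.2 (F.mono ((s⁻¹).monotone hab.le)))
    intro A hA
    conv_lhs => rw [e]
    rw [Measure.finsetSum_apply]
    exact Finset.sum_congr rfl fun s _ => by
      rw [Measure.smul_apply, Measure.map_apply s.continuous.measurable hA, smul_eq_mul]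

end IsSymmetricWalk

/-! ### Distribution functions and half indicators -/

/-- The right continuous distribution function of `ν`, vanishing at the origin. -/
noncomputable def rightDistribution (ν : Measure ℝ) (x : ℝ) : ℝ :=
  if 0 ≤ x then ν.real (Ioc 0 x) else -ν.real (Ioc x 0)

theorem measureReal_Ioc_add (ν : Measure ℝ) [IsLocallyFiniteMeasure ν] {x y z : ℝ} (hxy : x ≤ y)
    (hyz : y ≤ z) : ν.real (Ioc x y) + ν.real (Ioc y z) = ν.real (Ioc x z) := by
  rw [← Ioc_union_Ioc_eq_Ioc hxy hyz, measureReal_union (Ioc_disjoint_Ioc_of_le le_rfl)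
    measurableSet_Ioc measure_Ioc_lt_top.ne measure_Ioc_lt_top.ne]

theorem rightDistribution_sub (ν : Measure ℝ) [IsLocallyFiniteMeasure ν] {x y : ℝ} (hxy : x ≤ y) :
    rightDistribution ν y - rightDistribution ν x = ν.real (Ioc x y) := by
  unfold rightDistribution
  split_ifs with h1 h2 h2
  · linarith [measureReal_Ioc_add ν h2 hxy]
  · linarith [measureReal_Ioc_add ν (le_of_not_ge h2) h1]
  · linarith
  · linarith [measureReal_Ioc_add ν hxy (le_of_not_ge h1)]

theorem monotone_rightDistribution (ν : Measure ℝ) [IsLocallyFiniteMeasure ν] :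
    Monotone (rightDistribution ν) := fun x y hxy => by
  have := rightDistribution_sub ν hxy
  linarith [measureReal_nonneg (μ := ν) (s := Ioc x y)]

/-- The indicator of `y < x`, symmetrized on the diagonal. -/
noncomputable def halfIndicator (x y : ℝ) : ℝ := if y < x then 1 else if y = x then 1 / 2 else 0

theorem halfIndicator_nonneg (x y : ℝ) : 0 ≤ halfIndicator x y := by
  unfold halfIndicator; split_ifs <;> norm_num

theorem halfIndicator_le_one (x y : ℝ) : halfIndicator x y ≤ 1 := by
  unfold halfIndicator; split_ifs <;> norm_num

theorem halfIndicator_of_lt {x y : ℝ} (hxy : x < y) : halfIndicator x y = 0 := by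
  simp [halfIndicator, hxy.not_gt, hxy.ne']

theorem half_le_halfIndicator {x y : ℝ} (hxy : y ≤ x) : 1 / 2 ≤ halfIndicator x y := by
  unfold halfIndicator
  split_ifs with h1 h2
  · norm_num
  · exact le_rfl
  · exact absurd (hxy.lt_of_ne h2) h1

theorem halfIndicator_swap (x y : ℝ) : halfIndicator y x = 1 - halfIndicator x y := by
  unfold halfIndicator
  rcases lt_trichotomy x y with hlt | rfl | hlt
  · simp [hlt, hlt.not_gt, hlt.ne']
  · norm_num
  · simp [hlt, hlt.not_gt, hlt.ne']

theorem halfIndicator_apply_right (g : HomeoPlus) (x y : ℝ) :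
    halfIndicator x (g y) = halfIndicator (g⁻¹ x) y := by
  unfold halfIndicator
  have h1 : g y < x ↔ y < g⁻¹ x := g.lt_inv_apply.symm
  have h2 : g y = x ↔ y = g⁻¹ x :=
    ⟨fun e => by rw [← e, g.inv_apply_self], fun e => by rw [e, g.apply_inv_self]⟩
  simp only [h1, h2]

theorem measurable_halfIndicator {α : Type*} [MeasurableSpace α] {f g : α → ℝ} (hf : Measurable f)
    (hg : Measurable g) : Measurable fun a => halfIndicator (f a) (g a) :=
  Measurable.ite (measurableSet_lt hg hf) measurable_const
    (Measurable.ite (measurableSet_eq_fun hg hf) measurable_const measurable_const)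

theorem integral_halfIndicator (ν : Measure ℝ) [IsLocallyFiniteMeasure ν] {a b x : ℝ}
    (hx : x ∈ Ioc a b) : ∫ y in Ioc a b, halfIndicator x y ∂ν =
      rightDistribution ν x - rightDistribution ν a - ν.real {x} / 2 := by
  have e : ∀ y, halfIndicator x y =
      (Iic x).indicator (fun _ => (1 : ℝ)) y - ({x} : Set ℝ).indicator (fun _ => (1 / 2 : ℝ)) y := by
    intro y
    unfold halfIndicator
    rcases lt_trichotomy x y with hlt | rfl | hlt
    · simp [hlt.not_gt, hlt.ne', hlt]
    · norm_num
    · simp [hlt, hlt.le, hlt.ne]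
  have : IsFiniteMeasure (ν.restrict (Ioc a b)) := ⟨by simp [measure_Ioc_lt_top]⟩
  simp only [e]
  rw [integral_sub ((integrable_const _).indicator measurableSet_Iic)
    ((integrable_const _).indicator (measurableSet_singleton x)),
    integral_indicator_const _ measurableSet_Iic,
    integral_indicator_const _ (measurableSet_singleton x),
    measureReal_restrict_apply measurableSet_Iic,
    measureReal_restrict_apply (measurableSet_singleton x), rightDistribution_sub ν hx.1.le,
    singleton_inter_of_mem hx]
  have : Iic x ∩ Ioc a b = Ioc a x := by
    ext y; simp only [mem_inter_iff, mem_Iic, mem_Ioc]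
    exact ⟨fun h => ⟨h.2.1, h.1⟩, fun h => ⟨h.2, h.1, h.2.trans hx.2⟩⟩
  rw [this, smul_eq_mul, smul_eq_mul]; ring

/-! ### The jump kernel, its flux and the drift -/

/-- The mean signed jump of the walk across `y` when it starts from `x`. -/
noncomputable def jumpKernel (S : Finset HomeoPlus) (w : HomeoPlus → ℝ) (x y : ℝ) : ℝ :=
  ∑ s ∈ S, w s * (halfIndicator (s x) y - halfIndicator x y)

/-- The integral of the jump kernel over a rectangle. -/
noncomputable def jumpFlux (S : Finset HomeoPlus) (w : HomeoPlus → ℝ) (ν : Measure ℝ)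
    (L R : Set ℝ) : ℝ :=
  ∫ z in L ×ˢ R, jumpKernel S w z.1 z.2 ∂(ν.prod ν)

theorem measurable_jumpKernel (S : Finset HomeoPlus) (w : HomeoPlus → ℝ) :
    Measurable fun z : ℝ × ℝ => jumpKernel S w z.1 z.2 :=
  Finset.measurable_sum S fun s _ =>
    ((measurable_halfIndicator (s.continuous.measurable.comp measurable_fst) measurable_snd).sub
      (measurable_halfIndicator measurable_fst measurable_snd)).const_mul (w s)

theorem jumpKernel_of_lt (S : Finset HomeoPlus) (w : HomeoPlus → ℝ) {x y : ℝ} (hxy : x < y) :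
    jumpKernel S w x y = ∑ s ∈ S, w s * halfIndicator (s x) y := by
  simp only [jumpKernel, halfIndicator_of_lt hxy, sub_zero]

theorem exists_le_of_jumpKernel_ne_zero {S : Finset HomeoPlus} {w : HomeoPlus → ℝ} {x y : ℝ}
    (hxy : x < y) (hne : jumpKernel S w x y ≠ 0) : ∃ s ∈ S, y ≤ s x := by
  by_contra! hlt
  rw [jumpKernel_of_lt S w hxy] at hne
  exact hne (Finset.sum_eq_zero fun s hs => by rw [halfIndicator_of_lt (hlt s hs), mul_zero])

namespace IsWalkStationary

variable {S : Finset HomeoPlus} {w : HomeoPlus → ℝ} {ν : Measure ℝ} (hν : IsWalkStationary S w ν)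
include hν

/-- Each image of `ν` under an element of `S` is dominated by a multiple of `ν`; this transports
null sets. -/
theorem weight_mul_le {A : Set ℝ} (hA : MeasurableSet A) {s : HomeoPlus} (hs : s ∈ S) :
    ENNReal.ofReal (w s) * ν ((s : ℝ → ℝ) ⁻¹' A) ≤ ν A := by
  rw [hν A hA]
  exact Finset.single_le_sum
    (f := fun s : HomeoPlus => ENNReal.ofReal (w s) * ν ((s : ℝ → ℝ) ⁻¹' A)) (by simp) hs

theorem measureReal_eq_sum (hw : ∀ s ∈ S, 0 < w s) {A : Set ℝ} (hA : MeasurableSet A)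
    (hfin : ν A ≠ ⊤) : ν.real A = ∑ s ∈ S, w s * ν.real ((s : ℝ → ℝ) ⁻¹' A) := by
  rw [Measure.real, hν A hA, ENNReal.toReal_sum fun s hs =>
    ne_top_of_le_ne_top hfin (hν.weight_mul_le hA hs)]
  exact Finset.sum_congr rfl fun s hs => by
    rw [ENNReal.toReal_mul, ENNReal.toReal_ofReal (hw s hs).le]; rfl

end IsWalkStationary

namespace IsSymmetricWalk

variable {S : Finset HomeoPlus} {w : HomeoPlus → ℝ} (h : IsSymmetricWalk S w)
include h

/-- A jump from x across y by s is reversed by s⁻¹, which has the same weight. The value 1/2 on the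
diagonal keeps the identity exact when points carry mass. -/
theorem jumpKernel_swap (x y : ℝ) : jumpKernel S w y x = -jumpKernel S w x y := by
  unfold jumpKernel
  rw [← Finset.sum_neg_distrib, ← Finset.sum_congr rfl fun s _ => mul_neg _ _,
    ← h.sum_weight_mul_inv]
  refine Finset.sum_congr rfl fun s _ => ?_
  rw [halfIndicator_swap x y, halfIndicator_swap x (s⁻¹ y), halfIndicator_apply_right, inv_inv]
  ring

theorem abs_jumpKernel_le (x y : ℝ) : |jumpKernel S w x y| ≤ 1 := by
  refine (Finset.abs_sum_le_sum_abs _ _).trans (h.sum_eq_one ▸ Finset.sum_le_sum fun s hs => ?_)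
  rw [abs_mul, abs_of_pos (h.pos s hs)]
  refine mul_le_of_le_one_right (h.pos s hs).le (abs_sub_le_iff.2 ⟨?_, ?_⟩)
  · linarith [halfIndicator_nonneg x y, halfIndicator_le_one (s x) y]
  · linarith [halfIndicator_nonneg (s x) y, halfIndicator_le_one x y]

theorem jumpKernel_nonneg {x y : ℝ} (hxy : x < y) : 0 ≤ jumpKernel S w x y := by
  rw [jumpKernel_of_lt S w hxy]
  exact Finset.sum_nonneg fun s hs => mul_nonneg (h.pos s hs).le (halfIndicator_nonneg _ _)

theorem jumpKernel_pos {x y : ℝ} (hxy : x < y) {s : HomeoPlus} (hs : s ∈ S) (hy : y ≤ s x) :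
    0 < jumpKernel S w x y := by
  rw [jumpKernel_of_lt S w hxy]
  refine Finset.sum_pos' (fun s hs => mul_nonneg (h.pos s hs).le (halfIndicator_nonneg _ _))
    ⟨s, hs, mul_pos (h.pos s hs) ?_⟩
  linarith [half_le_halfIndicator hy]

section Flux

variable {ν : Measure ℝ} [IsLocallyFiniteMeasure ν]

theorem integrableOn_jumpKernel {L R : Set ℝ} (hL : ν L ≠ ⊤) (hR : ν R ≠ ⊤) :
    IntegrableOn (fun z : ℝ × ℝ => jumpKernel S w z.1 z.2) (L ×ˢ R) (ν.prod ν) :=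
  Measure.integrableOn_of_bounded (M := 1)
    (by rw [Measure.prod_prod]; exact ENNReal.mul_ne_top hL hR)
    (measurable_jumpKernel S w).aestronglyMeasurable
    (Filter.Eventually.of_forall fun z => h.abs_jumpKernel_le _ _)

theorem jumpFlux_swap (L R : Set ℝ) : jumpFlux S w ν R L = -jumpFlux S w ν L R := by
  unfold jumpFlux
  rw [← setIntegral_prod_swap, ← integral_neg]
  exact integral_congr_ae (Filter.Eventually.of_forall fun z => h.jumpKernel_swap _ _)

theorem jumpFlux_self (L : Set ℝ) : jumpFlux S w ν L L = 0 := by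
  have := h.jumpFlux_swap (ν := ν) L L
  linarith

theorem jumpFlux_union {L R R' : Set ℝ} (hR' : MeasurableSet R') (hLm : MeasurableSet L)
    (hd : Disjoint R R') (hL : ν L ≠ ⊤) (hR : ν R ≠ ⊤) (hR'' : ν R' ≠ ⊤) :
    jumpFlux S w ν L (R ∪ R') = jumpFlux S w ν L R + jumpFlux S w ν L R' := by
  unfold jumpFlux
  rw [prod_union, setIntegral_union (hd.set_prod_right _ _) (hLm.prod hR')
    (h.integrableOn_jumpKernel hL hR) (h.integrableOn_jumpKernel hL hR'')]

theorem jumpFlux_mono {L R L' R' : Set ℝ} (hLm : MeasurableSet L') (hRm : MeasurableSet R')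
    (hLR : ∀ x ∈ L', ∀ y ∈ R', x < y) (hL : L ⊆ L') (hR : R ⊆ R') (hfL : ν L' ≠ ⊤)
    (hfR : ν R' ≠ ⊤) : jumpFlux S w ν L R ≤ jumpFlux S w ν L' R' := by
  refine setIntegral_mono_set (h.integrableOn_jumpKernel hfL hfR) ?_
    (prod_mono hL hR).eventuallyLE
  exact ae_restrict_of_forall_mem (hLm.prod hRm) fun z hz =>
    h.jumpKernel_nonneg (hLR _ hz.1 _ hz.2)

omit [IsLocallyFiniteMeasure ν] in
theorem jumpFlux_nonneg {L R : Set ℝ} (hLm : MeasurableSet L) (hRm : MeasurableSet R)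
    (hLR : ∀ x ∈ L, ∀ y ∈ R, x < y) : 0 ≤ jumpFlux S w ν L R :=
  setIntegral_nonneg (hLm.prod hRm) fun _ hz => h.jumpKernel_nonneg (hLR _ hz.1 _ hz.2)

/-- The kernel is at most 1 and vanishes at (x, y) unless one step from x reaches y. Only the part
of the rectangle within reach of a jump counts. -/
theorem jumpFlux_le {L R L' R' : Set ℝ} (hLm : MeasurableSet L) (hRm : MeasurableSet R)
    (hLm' : MeasurableSet L') (hRm' : MeasurableSet R')
    (hLR : ∀ x ∈ L, ∀ y ∈ R, x < y) (hsub : ∀ x ∈ L, ∀ y ∈ R, ∀ s ∈ S, y ≤ s x → x ∈ L' ∧ y ∈ R')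
    (hfL : ν L ≠ ⊤) (hfR : ν R ≠ ⊤) (hfL' : ν L' ≠ ⊤) (hfR' : ν R' ≠ ⊤) :
    jumpFlux S w ν L R ≤ ν.real L' * ν.real R' := by
  have hfin : ν.prod ν (L' ×ˢ R') ≠ ⊤ := by
    rw [Measure.prod_prod]; exact ENNReal.mul_ne_top hfL' hfR'
  have hint : Integrable ((L' ×ˢ R').indicator fun _ => (1 : ℝ)) (ν.prod ν) :=
    (integrable_indicator_iff (hLm'.prod hRm')).2 (integrableOn_const hfin)
  calc jumpFlux S w ν L R
      ≤ ∫ z in L ×ˢ R, (L' ×ˢ R').indicator (fun _ => (1 : ℝ)) z ∂(ν.prod ν) := by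
        refine setIntegral_mono_on (h.integrableOn_jumpKernel hfL hfR) hint.integrableOn
          (hLm.prod hRm) fun z hz => ?_
        by_cases h0 : jumpKernel S w z.1 z.2 = 0
        · rw [h0]; exact indicator_nonneg (fun _ _ => zero_le_one) z
        · obtain ⟨s, hs, hle⟩ := exists_le_of_jumpKernel_ne_zero (hLR _ hz.1 _ hz.2) h0
          have hz' : z ∈ L' ×ˢ R' := hsub _ hz.1 _ hz.2 s hs hle
          rw [indicator_of_mem hz']
          exact (le_abs_self _).trans (h.abs_jumpKernel_le _ _)
    _ ≤ ∫ z, (L' ×ˢ R').indicator (fun _ => (1 : ℝ)) z ∂(ν.prod ν) :=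
        setIntegral_le_integral hint
          (Filter.Eventually.of_forall (indicator_nonneg fun _ _ => zero_le_one))
    _ = ν.real L' * ν.real R' := by
        rw [integral_indicator_const _ (hLm'.prod hRm'), measureReal_prod_prod, smul_eq_mul,
          mul_one]

variable (hν : IsWalkStationary S w ν)
include hν

theorem sum_weight_mul_measureReal_Ioc (a b : ℝ) :
    ∑ s ∈ S, w s * ν.real (Ioc (s a) (s b)) = ν.real (Ioc a b) := by
  rw [hν.measureReal_eq_sum h.pos measurableSet_Ioc measure_Ioc_lt_top.ne,
    ← h.sum_weight_mul_inv fun s => ν.real (Ioc (s a) (s b))]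
  simp only [HomeoPlus.preimage_Ioc]

theorem sum_weight_mul_measureReal_singleton (x : ℝ) :
    ∑ s ∈ S, w s * ν.real {s x} = ν.real {x} := by
  rw [hν.measureReal_eq_sum h.pos (measurableSet_singleton x) isCompact_singleton.measure_ne_top,
    ← h.sum_weight_mul_inv fun s => ν.real {s x}]
  refine Finset.sum_congr rfl fun s _ => ?_
  congr 2
  ext y
  simp only [mem_singleton_iff, mem_preimage]
  exact ⟨fun e => by rw [e, s.apply_inv_self], fun e => by rw [← e, s.inv_apply_self]⟩

/-- PF and F have the same increments, by stationarity and symmetry, so they differ by a constant.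
-/
theorem exists_drift : ∃ c : ℝ, ∀ x,
    ∑ s ∈ S, w s * rightDistribution ν (s x) = rightDistribution ν x + c := by
  have key : ∀ x y, x ≤ y → ∑ s ∈ S, w s * rightDistribution ν (s y) - rightDistribution ν y =
      ∑ s ∈ S, w s * rightDistribution ν (s x) - rightDistribution ν x := by
    intro x y hxy
    have h1 := h.sum_weight_mul_measureReal_Ioc hν x y
    rw [← rightDistribution_sub ν hxy, ← Finset.sum_congr rfl fun s _ => by
      rw [← rightDistribution_sub ν (s.monotone hxy)]] at h1
    simp only [mul_sub, Finset.sum_sub_distrib] at h1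
    linarith
  refine ⟨∑ s ∈ S, w s * rightDistribution ν (s 0) - rightDistribution ν 0, fun x => ?_⟩
  rcases le_total 0 x with hx | hx
  · linarith [key 0 x hx]
  · linarith [key x 0 hx]

variable {c : ℝ} (hc : ∀ x, ∑ s ∈ S, w s * rightDistribution ν (s x) = rightDistribution ν x + c)
include hc

/-- Integrating the half indicators gives PF - F at x, up to half-atom terms. These cancel because
the mass of atoms is harmonic. -/
theorem integral_jumpKernel {α β x : ℝ} (hx : x ∈ Ioc α β) (hs : ∀ s ∈ S, s x ∈ Ioc α β) :
    ∫ y in Ioc α β, jumpKernel S w x y ∂ν = c := by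
  have : IsFiniteMeasure (ν.restrict (Ioc α β)) := ⟨by simp [measure_Ioc_lt_top]⟩
  have hint : ∀ z, Integrable (fun y => halfIndicator z y) (ν.restrict (Ioc α β)) := fun z =>
    Integrable.of_bound (measurable_halfIndicator measurable_const measurable_id).aestronglyMeasurable
      1 (Filter.Eventually.of_forall fun y => by
        rw [Real.norm_eq_abs, abs_of_nonneg (halfIndicator_nonneg _ _)]
        exact halfIndicator_le_one _ _)
  unfold jumpKernel
  rw [integral_finsetSum (f := fun (s : HomeoPlus) y =>
    w s * (halfIndicator (s x) y - halfIndicator x y)) S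
    fun s _ => ((hint _).sub (hint _)).const_mul _]
  have e : ∀ s ∈ S, ∫ y in Ioc α β, w s * (halfIndicator (s x) y - halfIndicator x y) ∂ν =
      w s * rightDistribution ν (s x) - w s * rightDistribution ν x -
        (w s * ν.real {s x} - w s * ν.real {x}) / 2 := fun s hsS => by
    rw [integral_const_mul, integral_sub (hint _) (hint _), integral_halfIndicator ν hx,
      integral_halfIndicator ν (hs s hsS)]
    ring
  rw [Finset.sum_congr rfl e, Finset.sum_sub_distrib, Finset.sum_sub_distrib, ← Finset.sum_div,
    Finset.sum_sub_distrib, hc, h.sum_weight_mul_measureReal_singleton hν,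
    h.sum_weight_mul_const, h.sum_weight_mul_const]
  ring

/-- Integrate the kernel over x in (a, b] and y in (α, β]. Antisymmetry cancels the block (a, b] ×
(a, b] and reverses the sign of the block on the left. -/
theorem drift_mul_eq {α a b β : ℝ} (hab : a ≤ b) (hα : α ≤ a) (hβ : b ≤ β)
    (hαs : ∀ s ∈ S, α ≤ s a) (hβs : ∀ s ∈ S, s b ≤ β) :
    c * ν.real (Ioc a b) =
      jumpFlux S w ν (Ioc a b) (Ioc b β) - jumpFlux S w ν (Ioc α a) (Ioc a b) := by
  have fin : ∀ x y, ν (Ioc x y) ≠ ⊤ := fun x y => measure_Ioc_lt_top.ne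
  have h1 : jumpFlux S w ν (Ioc a b) (Ioc α β) = c * ν.real (Ioc a b) := by
    unfold jumpFlux
    rw [setIntegral_prod _ (h.integrableOn_jumpKernel (fin _ _) (fin _ _))]
    rw [setIntegral_congr_fun (g := fun _ => c) measurableSet_Ioc fun x hx => ?_,
      setIntegral_const, smul_eq_mul, mul_comm]
    exact h.integral_jumpKernel hν hc ⟨hα.trans_lt hx.1, hx.2.trans hβ⟩ fun s hs =>
      ⟨(hαs s hs).trans_lt (s.strictMono hx.1), (s.monotone hx.2).trans (hβs s hs)⟩
  rw [← h1, ← Ioc_union_Ioc_eq_Ioc (hα.trans hab) hβ, h.jumpFlux_union measurableSet_Ioc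
    measurableSet_Ioc (Ioc_disjoint_Ioc_of_le le_rfl) (fin _ _) (fin _ _) (fin _ _),
    ← Ioc_union_Ioc_eq_Ioc hα hab, h.jumpFlux_union measurableSet_Ioc
    measurableSet_Ioc (Ioc_disjoint_Ioc_of_le le_rfl) (fin _ _) (fin _ _) (fin _ _),
    h.jumpFlux_self, h.jumpFlux_swap (Ioc α a)]
  ring

end Flux

end IsSymmetricWalk

/-! ### Unboundedness of the distribution function and vanishing of the drift -/

namespace IsSymmetricWalk

variable {S : Finset HomeoPlus} {w : HomeoPlus → ℝ} (h : IsSymmetricWalk S w)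
variable {ν : Measure ℝ} [IsLocallyFiniteMeasure ν] (hν : IsWalkStationary S w ν)
include h

theorem exists_bounds (a b : ℝ) :
    ∃ α β, α < a ∧ b < β ∧ ∀ s ∈ S, α ≤ s a ∧ s b ≤ β := by
  obtain ⟨M, -, hM⟩ := h.exists_sup
  obtain ⟨m, -, hm⟩ := h.exists_inf
  obtain ⟨s, hs, hlt⟩ := h.exists_lt b
  obtain ⟨t, ht, hgt⟩ := h.exists_gt a
  exact ⟨m a, M b, (hm a t ht).trans_lt hgt, hlt.trans_le (hM b s hs),
    fun s hs => ⟨hm a s hs, hM b s hs⟩⟩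

include hν

/-- Mass has to flow across some point of the line. -/
theorem not_forall_jumpFlux_eq_zero (h0 : ν ≠ 0) :
    ¬ ∀ a, ∃ α₀ β₀, ∀ α ≤ α₀, ∀ β ≥ β₀, jumpFlux S w ν (Ioc α a) (Ioc a β) = 0 := by
  intro hflux
  -- Take `p` in the support of `ν`, pushed across a point `a` by some `s`. On a small neighbourhood
  -- `U` of `p`, zero flux across `a` makes the pairs (x, y) in U × s U with y ≤ s x null.
  obtain ⟨p, -, hp⟩ := exists_mem_forall_mem_nhdsWithin_pos_measure (μ := ν) (s := univ)
    (by simpa using h0)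
  simp only [nhdsWithin_univ] at hp
  obtain ⟨s, hs, hlt⟩ := h.exists_lt p
  obtain ⟨a, hpa, has⟩ := exists_between hlt
  obtain ⟨α₀, β₀, hz⟩ := hflux a
  set α := min α₀ (p - 1)
  set β := max β₀ (s p + 1)
  have hα : α < p := (min_le_right _ _).trans_lt (by linarith)
  have hβ : s p < β := lt_of_lt_of_le (by linarith) (le_max_right _ _)
  set U : Set ℝ := Ioo α a ∩ (s : ℝ → ℝ) ⁻¹' Ioo a β with hU
  have hUo : IsOpen U := isOpen_Ioo.inter (isOpen_Ioo.preimage s.continuous)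
  have hpU : p ∈ U := ⟨⟨hα, hpa⟩, has, hβ⟩
  have hUpos : 0 < ν U := hp U (hUo.mem_nhds hpU)
  have hzero := hz α (min_le_left _ _) β (le_max_left _ _)
  have hfin : ∀ x y, ν (Ioc x y) ≠ ⊤ := fun x y => measure_Ioc_lt_top.ne
  unfold jumpFlux at hzero
  have hm := measurableSet_Ioc (a := α) (b := a) |>.prod (measurableSet_Ioc (a := a) (b := β))
  rw [setIntegral_eq_zero_iff_of_nonneg_ae (ae_restrict_of_forall_mem hm fun z hz =>
    h.jumpKernel_nonneg (hz.1.2.trans_lt hz.2.1))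
    (h.integrableOn_jumpKernel (hfin _ _) (hfin _ _))] at hzero
  rw [Filter.EventuallyEq, ae_restrict_iff' hm] at hzero
  have hT : (ν.prod ν) {z | z.1 ∈ U ∧ s⁻¹ z.2 ∈ U ∧ z.2 ≤ s z.1} = 0 := by
    refine measure_mono_null (fun z hz => ?_) hzero
    obtain ⟨h1, h2, h3⟩ := hz
    simp only [mem_compl_iff, mem_ofPred_eq, Classical.not_imp]
    have hz2 : z.2 ∈ Ioo a β := by have := h2.2; rwa [mem_preimage, s.apply_inv_self] at this
    exact ⟨⟨Ioo_subset_Ioc_self h1.1, Ioo_subset_Ioc_self hz2⟩,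
      (h.jumpKernel_pos (h1.1.2.trans hz2.1) hs h3).ne'⟩
  have hUm : MeasurableSet U := hUo.measurableSet
  have hTm : MeasurableSet {z : ℝ × ℝ | z.1 ∈ U ∧ s⁻¹ z.2 ∈ U ∧ z.2 ≤ s z.1} :=
    (measurable_fst hUm).inter ((((s⁻¹).continuous.measurable.comp measurable_snd) hUm).inter
      (measurableSet_le measurable_snd (s.continuous.measurable.comp measurable_fst)))
  have hTm' : MeasurableSet {z : ℝ × ℝ | z.1 ∈ U ∧ z.2 ∈ U ∧ z.2 ≤ z.1} :=
    (measurable_fst hUm).inter ((measurable_snd hUm).inter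
      (measurableSet_le measurable_snd measurable_fst))
  -- Pull the second coordinate back by `s`, slice by slice, using `weight_mul_le`. This triangle
  -- and its mirror image cover U × U, which has positive mass.
  have hT' : (ν.prod ν) {z | z.1 ∈ U ∧ z.2 ∈ U ∧ z.2 ≤ z.1} = 0 := by
    rw [Measure.measure_prod_null hTm] at hT
    rw [Measure.measure_prod_null hTm']
    filter_upwards [hT] with x hx
    have := hν.weight_mul_le (measurable_prodMk_left hTm : MeasurableSet
      (Prod.mk x ⁻¹' {z : ℝ × ℝ | z.1 ∈ U ∧ s⁻¹ z.2 ∈ U ∧ z.2 ≤ s z.1})) hs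
    rw [hx, Pi.zero_apply, nonpos_iff_eq_zero, mul_eq_zero] at this
    rcases this with h1 | h1
    · exact absurd (ENNReal.ofReal_eq_zero.1 h1) (h.pos s hs).not_ge
    · refine measure_mono_null (fun y hy => ?_) h1
      obtain ⟨h1, h2, h3⟩ := hy
      exact ⟨h1, by simpa only [s.inv_apply_self] using h2, s.monotone h3⟩
  have hsw : (ν.prod ν) (Prod.swap ⁻¹' {z : ℝ × ℝ | z.1 ∈ U ∧ z.2 ∈ U ∧ z.2 ≤ z.1}) = 0 := by
    rw [← Measure.map_apply measurable_swap hTm', Measure.prod_swap, hT']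
  have hUU : (ν.prod ν) (U ×ˢ U) = 0 := by
    refine measure_mono_null (fun z hz => ?_) (measure_union_null hT' hsw)
    rcases le_total z.2 z.1 with hle | hle
    · exact Or.inl ⟨hz.1, hz.2, hle⟩
    · exact Or.inr ⟨hz.2, hz.1, hle⟩
  rw [Measure.prod_prod, mul_self_eq_zero] at hUU
  exact hUpos.ne' hUU

variable {c : ℝ} (hc : ∀ x, ∑ s ∈ S, w s * rightDistribution ν (s x) = rightDistribution ν x + c)
include hc

omit hν [IsLocallyFiniteMeasure ν] in
theorem drift_eq_zero_of_tendsto {l : Filter ℝ} [l.NeBot]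
    (hl : ∀ g : HomeoPlus, Filter.Tendsto (g : ℝ → ℝ) l l) {L : ℝ}
    (hL : Filter.Tendsto (rightDistribution ν) l (nhds L)) : c = 0 := by
  have h1 := tendsto_finsetSum S fun s _ => (hL.comp (hl s)).const_mul (w s)
  rw [h.sum_weight_mul_const] at h1
  have h2 := tendsto_nhds_unique (h1.congr fun x => hc x) (hL.add_const c)
  linarith

/-- If F had a finite limit at +∞, the drift would vanish and the flux across `a` would be passed on
to every later point b. It is then at most a constant times the mass beyond b, hence zero, for every
`a`. -/
theorem not_bddAbove_rightDistribution (h0 : ν ≠ 0) : ¬ BddAbove (range (rightDistribution ν)) := by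
  intro hb
  set L := ⨆ x, rightDistribution ν x
  have hL : Filter.Tendsto (rightDistribution ν) Filter.atTop (nhds L) :=
    tendsto_atTop_ciSup (monotone_rightDistribution ν) hb
  have hle : ∀ x, rightDistribution ν x ≤ L := le_ciSup hb
  obtain rfl := h.drift_eq_zero_of_tendsto hc
    (fun g => Filter.tendsto_atTop_atTop_of_monotone g.monotone fun b =>
      ⟨g⁻¹ b, (g.apply_inv_self b).ge⟩) hL
  have fin : ∀ x y, ν (Ioc x y) ≠ ⊤ := fun x y => measure_Ioc_lt_top.ne
  refine h.not_forall_jumpFlux_eq_zero hν h0 fun a => ?_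
  obtain ⟨α₀, _, hα, -, hs⟩ := h.exists_bounds a a
  refine ⟨α₀, a, fun α hαα β hβ => le_antisymm ?_ (h.jumpFlux_nonneg measurableSet_Ioc
    measurableSet_Ioc fun x hx y hy => hx.2.trans_lt hy.1)⟩
  have hlim : Filter.Tendsto (fun b => (L - rightDistribution ν a) * (L - rightDistribution ν b))
      Filter.atTop (nhds 0) := by
    simpa using (hL.const_sub L).const_mul (L - rightDistribution ν a)
  refine ge_of_tendsto hlim ((Filter.eventually_ge_atTop β).mono fun b hb' => ?_)
  have hab : a ≤ b := le_trans hβ hb'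
  obtain ⟨_, β', -, hβ', hs'⟩ := h.exists_bounds b b
  have h1 := h.drift_mul_eq hν hc hab (hαα.trans hα.le) hβ'.le
    (fun s hsS => hαα.trans (hs s hsS).1) (fun s hsS => (hs' s hsS).2)
  have h2 := h.jumpFlux_mono (ν := ν) (L := Ioc α a) (R := Ioc a β) (L' := Ioc α a)
    (R' := Ioc a b) measurableSet_Ioc measurableSet_Ioc
    (fun x hx y hy => hx.2.trans_lt hy.1) subset_rfl (Ioc_subset_Ioc_right hb') (fin _ _) (fin _ _)
  have h3 := h.jumpFlux_le (ν := ν) (L := Ioc a b) (R := Ioc b β') (L' := Ioc a b)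
    (R' := Ioc b β') measurableSet_Ioc measurableSet_Ioc measurableSet_Ioc measurableSet_Ioc
    (fun x hx y hy => hx.2.trans_lt hy.1) (fun x hx y hy _ _ _ => ⟨hx, hy⟩)
    (fin _ _) (fin _ _) (fin _ _) (fin _ _)
  rw [← rightDistribution_sub ν hab, ← rightDistribution_sub ν hβ'.le] at h3
  have h4 : (rightDistribution ν b - rightDistribution ν a) *
      (rightDistribution ν β' - rightDistribution ν b) ≤
      (L - rightDistribution ν a) * (L - rightDistribution ν b) :=
    mul_le_mul (by linarith [hle b]) (by linarith [hle β'])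
      (sub_nonneg.2 (monotone_rightDistribution ν hβ'.le)) (by linarith [hle a])
  linarith

theorem not_bddBelow_rightDistribution (h0 : ν ≠ 0) : ¬ BddBelow (range (rightDistribution ν)) := by
  intro hb
  set L := ⨅ x, rightDistribution ν x
  have hL : Filter.Tendsto (rightDistribution ν) Filter.atBot (nhds L) :=
    tendsto_atBot_ciInf (monotone_rightDistribution ν) hb
  have hle : ∀ x, L ≤ rightDistribution ν x := ciInf_le hb
  obtain rfl := h.drift_eq_zero_of_tendsto hc
    (fun g => Filter.tendsto_atBot_atBot_of_monotone g.monotone fun b =>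
      ⟨g⁻¹ b, (g.apply_inv_self b).le⟩) hL
  have fin : ∀ x y, ν (Ioc x y) ≠ ⊤ := fun x y => measure_Ioc_lt_top.ne
  refine h.not_forall_jumpFlux_eq_zero hν h0 fun b => ?_
  obtain ⟨_, β₀, -, hβ, hs⟩ := h.exists_bounds b b
  refine ⟨b, β₀, fun α hα β hββ => le_antisymm ?_ (h.jumpFlux_nonneg measurableSet_Ioc
    measurableSet_Ioc fun x hx y hy => hx.2.trans_lt hy.1)⟩
  have hlim : Filter.Tendsto (fun a => (rightDistribution ν a - L) * (rightDistribution ν b - L))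
      Filter.atBot (nhds 0) := by
    simpa using (hL.sub_const L).mul_const (rightDistribution ν b - L)
  refine ge_of_tendsto hlim ((Filter.eventually_le_atBot α).mono fun a ha' => ?_)
  have hab : a ≤ b := le_trans ha' hα
  obtain ⟨α', _, hα', -, hs'⟩ := h.exists_bounds a a
  have h1 := h.drift_mul_eq hν hc hab hα'.le (hβ.le.trans hββ)
    (fun s hsS => (hs' s hsS).1) (fun s hsS => (hs s hsS).2.trans hββ)
  have h2 := h.jumpFlux_mono (ν := ν) (L := Ioc α b) (R := Ioc b β) (L' := Ioc a b)
    (R' := Ioc b β) measurableSet_Ioc measurableSet_Ioc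
    (fun x hx y hy => hx.2.trans_lt hy.1) (Ioc_subset_Ioc_left ha') subset_rfl (fin _ _) (fin _ _)
  have h3 := h.jumpFlux_le (ν := ν) (L := Ioc α' a) (R := Ioc a b) (L' := Ioc α' a)
    (R' := Ioc a b) measurableSet_Ioc measurableSet_Ioc measurableSet_Ioc measurableSet_Ioc
    (fun x hx y hy => hx.2.trans_lt hy.1) (fun x hx y hy _ _ _ => ⟨hx, hy⟩)
    (fin _ _) (fin _ _) (fin _ _) (fin _ _)
  rw [← rightDistribution_sub ν hab, ← rightDistribution_sub ν hα'.le] at h3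
  have h4 : (rightDistribution ν a - rightDistribution ν α') *
      (rightDistribution ν b - rightDistribution ν a) ≤
      (rightDistribution ν a - L) * (rightDistribution ν b - L) :=
    mul_le_mul (by linarith [hle α']) (by linarith [hle a])
      (sub_nonneg.2 (monotone_rightDistribution ν hab)) (by linarith [hle a])
  linarith

/-- In the flux balance on (0, b], the flux across 0 is bounded independently of b and the flux
across b is non-negative, so c < 0 would bound ν(0, b]. The case c > 0 is the mirror image on (a,
0]. -/
theorem drift_eq_zero (h0 : ν ≠ 0) : c = 0 := by
  have fin : ∀ x y, ν (Ioc x y) ≠ ⊤ := fun x y => measure_Ioc_lt_top.ne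
  have hmono := monotone_rightDistribution ν
  obtain ⟨α, β, hα, hβ, hs⟩ := h.exists_bounds 0 0
  rcases lt_trichotomy c 0 with hneg | hzero | hpos
  · refine absurd ?_ (h.not_bddAbove_rightDistribution hν hc h0)
    refine ⟨ν.real (Ioc α 0) * ν.real (Ioc 0 β) / (-c) + rightDistribution ν 0, ?_⟩
    rintro _ ⟨x, rfl⟩
    refine (hmono (le_max_right 0 x)).trans ?_
    set b := max 0 x
    have hb : 0 ≤ b := le_max_left _ _
    obtain ⟨_, β', -, hβ', hs'⟩ := h.exists_bounds b b
    have h1 := h.drift_mul_eq hν hc hb hα.le hβ'.le (fun s hsS => (hs s hsS).1)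
      (fun s hsS => (hs' s hsS).2)
    have h2 := h.jumpFlux_nonneg (ν := ν) (measurableSet_Ioc (a := 0) (b := b))
      (measurableSet_Ioc (a := b) (b := β')) (fun x hx y hy => hx.2.trans_lt hy.1)
    have h3 := h.jumpFlux_le (ν := ν) (L := Ioc α 0) (R := Ioc 0 b) (L' := Ioc α 0)
      (R' := Ioc 0 β) measurableSet_Ioc measurableSet_Ioc measurableSet_Ioc measurableSet_Ioc
      (fun x hx y hy => hx.2.trans_lt hy.1)
      (fun x hx y hy s hsS hys => ⟨hx, hy.1, hys.trans ((s.monotone hx.2).trans (hs s hsS).2)⟩)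
      (fin _ _) (fin _ _) (fin _ _) (fin _ _)
    rw [← sub_le_iff_le_add, le_div_iff₀ (neg_pos.2 hneg), rightDistribution_sub ν hb]
    linarith
  · exact hzero
  · refine absurd ?_ (h.not_bddBelow_rightDistribution hν hc h0)
    refine ⟨rightDistribution ν 0 - ν.real (Icc α 0) * ν.real (Ioc 0 β) / c, ?_⟩
    rintro _ ⟨x, rfl⟩
    refine le_trans ?_ (hmono (min_le_right 0 x))
    set a := min 0 x
    have ha : a ≤ 0 := min_le_left _ _
    obtain ⟨α', _, hα', -, hs'⟩ := h.exists_bounds a a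
    have h1 := h.drift_mul_eq hν hc ha hα'.le hβ.le (fun s hsS => (hs' s hsS).1)
      (fun s hsS => (hs s hsS).2)
    have h2 := h.jumpFlux_nonneg (ν := ν) (measurableSet_Ioc (a := α') (b := a))
      (measurableSet_Ioc (a := a) (b := 0)) (fun x hx y hy => hx.2.trans_lt hy.1)
    -- A point x with s x > 0 satisfies α ≤ s⁻¹ 0 ≤ x. Equality with `α` is not ruled out, hence the
    -- closed interval.
    have h3 := h.jumpFlux_le (ν := ν) (L := Ioc a 0) (R := Ioc 0 β) (L' := Icc α 0)
      (R' := Ioc 0 β) measurableSet_Ioc measurableSet_Ioc measurableSet_Icc measurableSet_Ioc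
      (fun x hx y hy => hx.2.trans_lt hy.1)
      (fun x hx y hy s hsS hys => ⟨⟨((hs _ (h.inv_mem s hsS)).1.trans
        (s.inv_apply_le.2 (hy.1.le.trans hys))), hx.2⟩, hy⟩)
      (fin _ _) (fin _ _) measure_Icc_lt_top.ne (fin _ _)
    rw [sub_le_comm, div_eq_mul_inv, ← div_eq_mul_inv, le_div_iff₀ hpos,
      rightDistribution_sub ν ha]
    linarith

end IsSymmetricWalk

/-! ### Atoms have constant mass along orbits -/

theorem sum_indicator_measureReal_singleton_le (ν : Measure ℝ) [IsLocallyFiniteMeasure ν] (a b : ℝ)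
    (T : Finset ℝ) :
    ∑ x ∈ T, (Icc a b).indicator (fun x => ν.real {x}) x ≤ ν.real (Icc a b) := by
  classical
  simp only [indicator_apply]
  rw [← Finset.sum_filter, sum_measureReal_singleton]
  exact measureReal_mono (fun x hx => (Finset.mem_filter.1 hx).2) measure_Icc_lt_top.ne

theorem summable_indicator_measureReal_singleton (ν : Measure ℝ) [IsLocallyFiniteMeasure ν]
    (a b : ℝ) : Summable ((Icc a b).indicator fun x => ν.real {x}) :=
  summable_of_sum_le (indicator_nonneg fun _ _ => measureReal_nonneg)
    (sum_indicator_measureReal_singleton_le ν a b)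

theorem tsum_indicator_measureReal_singleton_le (ν : Measure ℝ) [IsLocallyFiniteMeasure ν]
    (a b : ℝ) : ∑' x, (Icc a b).indicator (fun x => ν.real {x}) x ≤ ν.real (Icc a b) :=
  (summable_indicator_measureReal_singleton ν a b).tsum_le_of_sum_le
    (sum_indicator_measureReal_singleton_le ν a b)

namespace IsSymmetricWalk

variable {S : Finset HomeoPlus} {w : HomeoPlus → ℝ} (h : IsSymmetricWalk S w)
include h

theorem sum_weight_mul_sqrt_le {t : HomeoPlus → ℝ} (ht : ∀ s ∈ S, 0 ≤ t s) :
    ∑ s ∈ S, w s * √(t s) ≤ √(∑ s ∈ S, w s * t s) := by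
  simpa only [smul_eq_mul] using Real.strictConcaveOn_sqrt.concaveOn.le_map_sum
    (fun s hs => (h.pos s hs).le) h.sum_eq_one ht

/-- The square root of `|D|` is superharmonic outside of a compact interval. -/
theorem exists_sqrt_superharmonic {D : ℝ → ℝ} (hD : Monotone D) (hh : ∀ x, IsHarmonicAt S w D x)
    (hA : ¬ BddAbove (range D)) (hB : ¬ BddBelow (range D)) :
    ∃ a b, ∀ x ∉ Icc a b, ∑ s ∈ S, w s * √|D (s x)| ≤ √|D x| := by
  obtain ⟨_, ⟨y, rfl⟩, hy⟩ := not_bddAbove_iff.1 hA 0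
  obtain ⟨_, ⟨z, rfl⟩, hz⟩ := not_bddBelow_iff.1 hB 0
  obtain ⟨_, b, -, hb, hbs⟩ := h.exists_bounds y y
  obtain ⟨a, _, ha, -, has⟩ := h.exists_bounds z z
  refine ⟨a, b, fun x hx => ?_⟩
  rw [mem_Icc, not_and_or, not_le, not_le] at hx
  -- Far enough out, all points s x lie where D has the same sign. There |D| is harmonic, and
  -- Jensen's inequality for the square root applies.
  rcases hx with hx | hx
  · have hs : ∀ s ∈ S, D (s x) ≤ 0 := fun s hs => (hD (s.le_inv_apply.1
      (hx.le.trans (has _ (h.inv_mem s hs)).1))).trans hz.le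
    have e : ∑ s ∈ S, w s * √|D (s x)| = ∑ s ∈ S, w s * √(-D (s x)) :=
      Finset.sum_congr rfl fun s hsS => by rw [abs_of_nonpos (hs s hsS)]
    have e' : -D x = ∑ s ∈ S, w s * -D (s x) := by
      simp only [mul_neg, Finset.sum_neg_distrib]; rw [hh x]
    rw [e, abs_of_nonpos ((hD (hx.le.trans ha.le)).trans hz.le), e']
    exact h.sum_weight_mul_sqrt_le fun s hsS => neg_nonneg.2 (hs s hsS)
  · have hs : ∀ s ∈ S, 0 ≤ D (s x) := fun s hs => hy.le.trans (hD (s.inv_apply_le.1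
      ((hbs _ (h.inv_mem s hs)).2.trans hx.le)))
    have e : ∑ s ∈ S, w s * √|D (s x)| = ∑ s ∈ S, w s * √(D (s x)) :=
      Finset.sum_congr rfl fun s hsS => by rw [abs_of_nonneg (hs s hsS)]
    rw [e, abs_of_nonneg (hy.le.trans (hD (hb.le.trans hx.le))), ← hh x]
    exact h.sum_weight_mul_sqrt_le hs

/-- P is self-adjoint for counting measure on the line: each s permutes the points, and s, s⁻¹ have
equal weights. -/
theorem hasSum_weight_swap {θ ψ : ℝ → ℝ} (hs : ∀ g : HomeoPlus, Summable fun x => θ x * ψ (g x)) :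
    ∃ A, HasSum (fun x => (θ x - ∑ s ∈ S, w s * θ (s x)) * ψ x) A ∧
      HasSum (fun x => θ x * (ψ x - ∑ s ∈ S, w s * ψ (s x))) A := by
  set A : HomeoPlus → ℝ := fun g => ∑' x, θ x * ψ (g x)
  have h1 : HasSum (fun x => θ x * ψ x) (A 1) := (hs 1).hasSum
  refine ⟨A 1 - ∑ s ∈ S, w s * A s, ?_, ?_⟩
  · rw [← h.sum_weight_mul_inv A]
    have h2 : ∀ s : HomeoPlus, HasSum (fun x => θ (s x) * ψ x) (A s⁻¹) := fun s => by
      have := ((s : ℝ ≃ₜ ℝ).toEquiv.hasSum_iff).2 (hs s⁻¹).hasSum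
      exact this.congr_fun fun x => congrArg (θ (s x) * ψ ·) (s.inv_apply_self x).symm
    refine (h1.sub (hasSum_sum fun s _ => (h2 s).mul_left (w s))).congr_fun fun x => ?_
    rw [sub_mul, Finset.sum_mul]
    simp only [mul_assoc]
  · refine (h1.sub (hasSum_sum fun s _ => ((hs s).hasSum).mul_left (w s))).congr_fun fun x => ?_
    rw [mul_sub, Finset.mul_sum]
    simp only [mul_left_comm]

/-- Test the defect θ - Pθ ≥ 0 against cutoffs ψ = max(0, 1 - √|D| / R) and move P onto ψ. Outside
[a, b] one has ψ ≤ Pψ, while inside ψ - Pψ ≤ C / R, so the total defect tends to 0 as R grows. -/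
theorem isHarmonicAt_of_superharmonic_le_atoms {ν : Measure ℝ} [IsLocallyFiniteMeasure ν]
    {D : ℝ → ℝ} (hD : Monotone D) (hh : ∀ x, IsHarmonicAt S w D x)
    (hA : ¬ BddAbove (range D)) (hB : ¬ BddBelow (range D)) {θ : ℝ → ℝ} (hθ : ∀ x, 0 ≤ θ x)
    (hθν : ∀ x, θ x ≤ ν.real {x}) (hsup : ∀ x, ∑ s ∈ S, w s * θ (s x) ≤ θ x) (x : ℝ) :
    IsHarmonicAt S w θ x := by
  obtain ⟨a, b, hab⟩ := h.exists_sqrt_superharmonic hD hh hA hB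
  set V : ℝ → ℝ := fun x => √|D x| with hV
  have hV0 : ∀ x, 0 ≤ V x := fun x => Real.sqrt_nonneg _
  set C : ℝ := ∑ s ∈ S, w s * √(|D (s a)| + |D (s b)|) with hC
  have hC0 : 0 ≤ C :=
    Finset.sum_nonneg fun s hs => mul_nonneg (h.pos s hs).le (Real.sqrt_nonneg _)
  have hVC : ∀ y ∈ Icc a b, ∑ s ∈ S, w s * V (s y) ≤ C := fun y hy =>
    Finset.sum_le_sum fun s hs => mul_le_mul_of_nonneg_left (Real.sqrt_le_sqrt
      ((abs_le_max_abs_abs (hD (s.monotone hy.1)) (hD (s.monotone hy.2))).trans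
        (max_le_add_of_nonneg (abs_nonneg _) (abs_nonneg _)))) (h.pos s hs).le
  have main : ∀ R > 0, (θ x - ∑ s ∈ S, w s * θ (s x)) * (1 - V x / R) ≤
      ν.real (Icc a b) * (C / R) := by
    intro R hR
    set ψ : ℝ → ℝ := fun y => max 0 (1 - V y / R) with hψ
    have hψ0 : ∀ y, 0 ≤ ψ y := fun y => le_max_left _ _
    have hψ1 : ∀ y, ψ y ≤ 1 := fun y =>
      max_le zero_le_one (sub_le_self _ (div_nonneg (hV0 y) hR.le))
    have hPψ : ∀ y, 1 - (∑ s ∈ S, w s * V (s y)) / R ≤ ∑ s ∈ S, w s * ψ (s y) := by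
      intro y
      have e : 1 - (∑ s ∈ S, w s * V (s y)) / R = ∑ s ∈ S, w s * (1 - V (s y) / R) := by
        simp only [mul_sub, mul_one, Finset.sum_sub_distrib, h.sum_eq_one, Finset.sum_div,
          mul_div_assoc]
      rw [e]
      exact Finset.sum_le_sum fun s hs =>
        mul_le_mul_of_nonneg_left (le_max_right _ _) (h.pos s hs).le
    have hsupp : ∃ u v, ∀ y ∉ Icc u v, ψ y = 0 := by
      obtain ⟨_, ⟨v, rfl⟩, hv⟩ := not_bddAbove_iff.1 hA (R ^ 2)
      obtain ⟨_, ⟨u, rfl⟩, hu⟩ := not_bddBelow_iff.1 hB (-R ^ 2)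
      refine ⟨u, v, fun y hy => max_eq_left ?_⟩
      have : R ≤ V y := by
        refine Real.le_sqrt_of_sq_le ?_
        rw [mem_Icc, not_and_or, not_le, not_le] at hy
        rcases hy with hy | hy
        · exact le_trans (by linarith [hD hy.le]) (neg_le_abs _)
        · exact le_trans (by linarith [hD hy.le]) (le_abs_self _)
      rw [sub_nonpos, one_le_div hR]
      exact this
    obtain ⟨u, v, huv⟩ := hsupp
    have hsum : ∀ g : HomeoPlus, Summable fun y => θ y * ψ (g y) := by
      intro g
      refine Summable.of_nonneg_of_le (fun y => mul_nonneg (hθ y) (hψ0 _)) (fun y => ?_)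
        (summable_indicator_measureReal_singleton ν (g⁻¹ u) (g⁻¹ v))
      by_cases hy : y ∈ Icc (g⁻¹ u) (g⁻¹ v)
      · rw [indicator_of_mem hy]
        exact (mul_le_of_le_one_right (hθ y) (hψ1 _)).trans (hθν y)
      · rw [indicator_of_notMem hy, huv (g y) fun hgy =>
          hy ⟨g.inv_apply_le.2 hgy.1, g.le_inv_apply.2 hgy.2⟩, mul_zero]
    obtain ⟨A, hA1, hA2⟩ := h.hasSum_weight_swap hsum
    have hle : A ≤ ν.real (Icc a b) * (C / R) := by
      have hsK := (summable_indicator_measureReal_singleton ν a b).hasSum.mul_right (C / R)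
      refine (hasSum_le (fun y => ?_) hA2 hsK).trans (mul_le_mul_of_nonneg_right
        (tsum_indicator_measureReal_singleton_le ν a b) (div_nonneg hC0 hR.le))
      by_cases hy : y ∈ Icc a b
      · rw [indicator_of_mem hy]
        refine (mul_le_mul_of_nonneg_left ?_ (hθ y)).trans
          (mul_le_mul_of_nonneg_right (hθν y) (div_nonneg hC0 hR.le))
        have := hPψ y
        have := hψ1 y
        have := div_le_div_of_nonneg_right (hVC y hy) hR.le
        linarith
      · rw [indicator_of_notMem hy, zero_mul]
        refine mul_nonpos_of_nonneg_of_nonpos (hθ y) (sub_nonpos.2 (max_le ?_ ?_))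
        · exact Finset.sum_nonneg fun s hs => mul_nonneg (h.pos s hs).le (hψ0 _)
        · refine le_trans ?_ (hPψ y)
          have := div_le_div_of_nonneg_right (hab y hy) hR.le
          linarith
    refine le_trans ?_ hle
    refine (mul_le_mul_of_nonneg_left (le_max_right 0 _) (sub_nonneg.2 (hsup x))).trans ?_
    exact le_hasSum hA1 x fun y _ => mul_nonneg (sub_nonneg.2 (hsup y)) (hψ0 y)
  refine le_antisymm (hsup x) ?_
  by_contra! hlt
  set k := θ x - ∑ s ∈ S, w s * θ (s x)
  have hk : 0 < k := sub_pos.2 hlt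
  set B := ν.real (Icc a b) * C
  have hB0 : 0 ≤ B := mul_nonneg measureReal_nonneg hC0
  -- With this R, the left side of `main` multiplied by R is B + k, which exceeds the permitted B.
  have hR : 0 < V x + B / k + 1 := by have := hV0 x; positivity
  have h1 := main _ hR
  have h2 : (1 - V x / (V x + B / k + 1)) * (V x + B / k + 1) = B / k + 1 := by
    rw [sub_mul, div_mul_cancel₀ _ hR.ne']; ring
  have h3 : k * (B / k + 1) = B + k := by field_simp
  rw [← mul_div_assoc, le_div_iff₀ hR, mul_assoc, h2, h3] at h1
  linarith

variable {ν : Measure ℝ} [IsLocallyFiniteMeasure ν] (hν : IsWalkStationary S w ν)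
include hν

theorem isHarmonicAt_rightDistribution (h0 : ν ≠ 0) (x : ℝ) :
    IsHarmonicAt S w (rightDistribution ν) x := by
  obtain ⟨c, hc⟩ := h.exists_drift hν
  obtain rfl := h.drift_eq_zero hν hc h0
  simpa [IsHarmonicAt] using hc x

/-- The atoms of a stationary measure have constant mass along the orbits. -/
theorem measureReal_singleton_apply (h0 : ν ≠ 0) (x : ℝ) {s : HomeoPlus} (hs : s ∈ S) :
    ν.real {s x} = ν.real {x} := by
  obtain ⟨c, hc⟩ := h.exists_drift hν
  have key : ∀ x, ∀ s ∈ S, ν.real {x} ≤ ν.real {s x} := by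
    intro x s hs
    -- Truncate at the level ν{x}: at x itself the truncation is maximal, so harmonicity there
    -- forces every s x to attain the same level.
    have hharm := h.isHarmonicAt_of_superharmonic_le_atoms (ν := ν) (monotone_rightDistribution ν)
      (h.isHarmonicAt_rightDistribution hν h0) (h.not_bddAbove_rightDistribution hν hc h0)
      (h.not_bddBelow_rightDistribution hν hc h0) (θ := fun y => min (ν.real {y}) (ν.real {x}))
      (fun y => le_min measureReal_nonneg measureReal_nonneg) (fun y => min_le_left _ _)
      (fun y => le_min ?_ ?_) x
    · unfold IsHarmonicAt at hharm
      dsimp only at hharm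
      rw [min_self] at hharm
      have h1 : ∑ t ∈ S, w t * (ν.real {x} - min (ν.real {t x}) (ν.real {x})) = 0 := by
        simp only [mul_sub, Finset.sum_sub_distrib]
        rw [hharm, h.sum_weight_mul_const, sub_self]
      have h2 := (Finset.sum_eq_zero_iff_of_nonneg fun t ht =>
        mul_nonneg (h.pos t ht).le (sub_nonneg.2 (min_le_right _ _))).1 h1 s hs
      rcases mul_eq_zero.1 h2 with h3 | h3
      · exact absurd h3 (h.pos s hs).ne'
      · rw [sub_eq_zero.1 h3]; exact min_le_left _ _
    · rw [← h.sum_weight_mul_measureReal_singleton hν y]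
      exact Finset.sum_le_sum fun t ht =>
        mul_le_mul_of_nonneg_left (min_le_left _ _) (h.pos t ht).le
    · conv_rhs => rw [← h.sum_weight_mul_const (ν.real {x})]
      exact Finset.sum_le_sum fun t ht =>
        mul_le_mul_of_nonneg_left (min_le_right _ _) (h.pos t ht).le
  refine le_antisymm ?_ (key x s hs)
  simpa only [s.inv_apply_self] using key (s x) s⁻¹ (h.inv_mem s hs)

end IsSymmetricWalk

/-! ### Absence of atoms and descent of the action -/

theorem HomeoPlus.ext {g k : HomeoPlus} (hgk : ∀ x, g x = k x) : g = k :=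
  Subtype.ext (Homeomorph.ext hgk)

/-- A compact interval has finite mass, so it contains finitely many atoms of a given positive mass;
the orbit is therefore locally finite. -/
theorem isDiscreteOrbit_of_measureReal_pos {ν : Measure ℝ} [IsLocallyFiniteMeasure ν]
    {G : Subgroup HomeoPlus} {x : ℝ} (hG : ∀ g ∈ G, ν.real {g x} = ν.real {x})
    (hx : 0 < ν.real {x}) : IsDiscreteOrbit G x := by
  have hfin : ∀ a b, (lineOrbit G x ∩ Icc a b).Finite := by
    intro a b
    have h1 := (summable_indicator_measureReal_singleton ν a b).tendsto_cofinite_zero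
    have h2 := h1.eventually (gt_mem_nhds hx)
    rw [Filter.eventually_cofinite] at h2
    refine h2.subset ?_
    rintro y ⟨⟨g, hg, rfl⟩, hy⟩
    simp only [mem_ofPred_eq, not_lt, indicator_of_mem hy, hG g hg, le_rfl]
  have := (isClosed_and_discrete_iff (S := lineOrbit G x)).2 fun z => by
    rw [Filter.disjoint_principal_right]
    have hF : ((lineOrbit G x ∩ Icc (z - 1) (z + 1)) \ {z}).Finite := (hfin _ _).subset sdiff_subset
    filter_upwards [nhdsWithin_le_nhds (hF.isClosed.isOpen_compl.mem_nhds (by simp : z ∉ _)),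
      nhdsWithin_le_nhds (Icc_mem_nhds (sub_one_lt z) (lt_add_one z)),
      self_mem_nhdsWithin] with y h1 h2 h3 h4
    exact h1 ⟨⟨h4, h2⟩, h3⟩
  exact ⟨this.1, this.2.to_subtype⟩

theorem distributionFunction_eq (ν : Measure ℝ) [IsLocallyFiniteMeasure ν] [NullSingletonClass ν] (x₀ x : ℝ) :
    distributionFunction ν x₀ x = rightDistribution ν x - rightDistribution ν x₀ := by
  unfold distributionFunction
  split_ifs with hx
  · rw [rightDistribution_sub ν hx, Measure.real, Measure.real, measure_congr Ioc_ae_eq_Icc]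
  · rw [← neg_sub (rightDistribution ν x₀), rightDistribution_sub ν (not_le.1 hx).le, Measure.real,
      Measure.real, measure_congr Ioc_ae_eq_Icc]

theorem continuous_rightDistribution (ν : Measure ℝ) [IsLocallyFiniteMeasure ν] [NullSingletonClass ν] :
    Continuous (rightDistribution ν) := by
  have h := intervalIntegral.continuous_primitive (μ := ν) (f := fun _ => (1 : ℝ))
    (fun a b => intervalIntegrable_const) 0
  refine h.congr fun x => ?_
  rw [intervalIntegral.integral_const', smul_eq_mul, mul_one]
  unfold rightDistribution
  split_ifs with hx
  · rw [Ioc_eq_empty_of_le hx]; simp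
  · rw [Ioc_eq_empty_of_le (not_le.1 hx).le]; simp

/-- An action which preserves the fibres of a continuous non-decreasing surjection descends to its
target. -/
theorem exists_isSemiconjugacy {G : Subgroup HomeoPlus} {D : ℝ → ℝ} (hc : Continuous D)
    (hm : Monotone D) (hs : Function.Surjective D)
    (hG : ∀ g ∈ G, ∀ x y, D x = D y → D (g x) = D (g y)) :
    ∃ ρ : G →* HomeoPlus, IsSemiconjugacy ρ D := by
  set σ := Function.surjInv hs
  have hσ : ∀ t, D (σ t) = t := Function.surjInv_eq hs
  -- Preservation of fibres makes D ∘ g ∘ σ independent of the section σ; this yields inverses,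
  -- multiplicativity and equivariance.
  have hdesc : ∀ g ∈ G, ∀ x, D (g (σ (D x))) = D (g x) := fun g hg x => hG g hg _ _ (hσ _)
  have hmono : ∀ g : HomeoPlus, Monotone fun t => D (g (σ t)) := by
    intro g t u htu
    rcases htu.eq_or_lt with rfl | hlt
    · exact le_rfl
    · refine hm (g.monotone ?_)
      by_contra! hle
      have := hm hle.le
      rw [hσ, hσ] at this
      exact this.not_gt hlt
  have hinv : ∀ g ∈ G, ∀ t, D (g (σ (D (g⁻¹ (σ t))))) = t := fun g hg t => by
    rw [hdesc g hg, g.apply_inv_self, hσ]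
  let e : G → (ℝ ≃ ℝ) := fun g =>
    { toFun := fun t => D ((g : HomeoPlus) (σ t))
      invFun := fun t => D ((g : HomeoPlus)⁻¹ (σ t))
      left_inv := fun t => by
        have := hinv _ (G.inv_mem g.2) t
        rwa [inv_inv] at this
      right_inv := hinv _ g.2 }
  let ψ : G → HomeoPlus := fun g =>
    let o := (e g).toOrderIso (hmono g) (hmono (g : HomeoPlus)⁻¹)
    ⟨o.toHomeomorph, o.strictMono⟩
  have hψ : ∀ (g : G) t, ψ g t = D ((g : HomeoPlus) (σ t)) := fun _ _ => rfl
  refine ⟨MonoidHom.mk' ψ fun g k => HomeoPlus.ext fun t => ?_, hc, hm, hs, fun g x => ?_⟩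
  · rw [HomeoPlus.mul_apply, hψ, hψ, hψ, hdesc _ g.2]; rfl
  · exact (hdesc _ g.2 x).symm

theorem PMF.hasSum_map_toReal_mul {α β : Type*} (p : PMF α) (f : α → β) (F : β → ℝ) (T : Finset α)
    (hT : ∀ a ∉ T, p a = 0) :
    HasSum (fun b => (p.map f b).toReal * F b) (∑ a ∈ T, (p a).toReal * F (f a)) := by
  classical
  have e : ∀ b, (p.map f b).toReal * F b =
      ∑ a ∈ T, if b = f a then (p a).toReal * F (f a) else 0 := by
    intro b
    rw [PMF.map_apply, tsum_eq_sum (s := T) fun a ha => by rw [hT a ha, ite_self],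
      ENNReal.toReal_sum fun a _ => by split_ifs; exacts [p.apply_ne_top a, ENNReal.zero_ne_top],
      Finset.sum_mul]
    refine Finset.sum_congr rfl fun a _ => ?_
    split_ifs with hb
    · rw [hb]
    · simp
  simp only [e]
  exact hasSum_sum fun a _ => hasSum_ite_eq (f a) _

theorem mainTheorem2 (μ : PMF HomeoPlus) (hfin : μ.support.Finite) (hsymm : IsSymmetricPMF μ)
    (hirr : IsIrreducibleAction (generatedGroup μ))
    (hdisc : ∀ x : ℝ, ¬ IsDiscreteOrbit (generatedGroup μ) x) :
    (∃ ν : MeasureTheory.Measure ℝ, IsStationaryRadon μ ν) ∧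
    ∀ ν : MeasureTheory.Measure ℝ, IsStationaryRadon μ ν → ∀ x₀ : ℝ,
      ∃ ρ : generatedGroup μ →* HomeoPlus,
        IsSemiconjugacy ρ (distributionFunction ν x₀) ∧
        HasDerriennicProperty ρ.range ((onGeneratedGroup μ).map ρ.rangeRestrict) := by
  have h := isSymmetricWalk_of_pmf μ hfin hsymm hirr
  refine ⟨?_, fun ν hν x₀ => ?_⟩
  · obtain ⟨ν, h1, h2, h3⟩ := h.exists_stationary
    exact ⟨ν, h1, h2, (isStationaryMeasure_iff μ hfin ν).2 h3⟩
  have := hν.locallyFinite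
  have h0 := hν.ne_zero
  have hst := (isStationaryMeasure_iff μ hfin ν).1 hν.stationary
  obtain ⟨c, hc⟩ := h.exists_drift hst
  have hmemG : ∀ s ∈ hfin.toFinset, s ∈ generatedGroup μ := fun s hs =>
    Subgroup.subset_closure (by simpa using hs)
  have hind : ∀ {p : HomeoPlus → Prop}, p 1 → (∀ g k, p g → p k → p (g * k)) →
      (∀ s ∈ hfin.toFinset, p s) → ∀ g ∈ generatedGroup μ, p g := by
    intro p p1 pmul ps g hg
    -- Carrying the property for g and g⁻¹ together disposes of inverses, since the support is
    -- symmetric.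
    refine (Subgroup.closure_induction (p := fun g _ => p g ∧ p g⁻¹) (fun s hs => ?_) ?_ ?_ ?_ hg).1
    · have hs' : s ∈ hfin.toFinset := by simpa using hs
      exact ⟨ps s hs', ps _ (h.inv_mem s hs')⟩
    · exact ⟨p1, by rwa [inv_one]⟩
    · exact fun a b _ _ ha hb => ⟨pmul _ _ ha.1 hb.1, by rw [mul_inv_rev]; exact pmul _ _ hb.2 ha.2⟩
    · exact fun a _ ha => ⟨ha.2, by rw [inv_inv]; exact ha.1⟩
  have hatom : ∀ g ∈ generatedGroup μ, ∀ x, ν.real {g x} = ν.real {x} :=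
    hind (p := fun g => ∀ x, ν.real {g x} = ν.real {x}) (fun _ => rfl)
      (fun g k hg hk x => by rw [HomeoPlus.mul_apply, hg, hk])
      (fun s hs x => h.measureReal_singleton_apply hst h0 x hs)
  have hno : NullSingletonClass ν := ⟨fun x => by
    by_contra hx
    exact hdisc x (isDiscreteOrbit_of_measureReal_pos (fun g hg => hatom g hg x)
      (ENNReal.toReal_pos hx isCompact_singleton.measure_ne_top))⟩
  -- Fibres of the distribution function are governed by null intervals, so this is the fibre
  -- preservation needed for the descent.
  have hnull : ∀ g ∈ generatedGroup μ, ∀ x y, ν (Ioc x y) = 0 → ν (Ioc (g x) (g y)) = 0 :=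
    hind (p := fun g => ∀ x y, ν (Ioc x y) = 0 → ν (Ioc (g x) (g y)) = 0) (fun _ _ h => h)
      (fun g k hg hk x y hxy => hg _ _ (hk _ _ hxy)) fun s hs x y hxy => by
        have := hst.weight_mul_le (measurableSet_Ioc (a := x) (b := y)) (h.inv_mem s hs)
        rw [hxy, nonpos_iff_eq_zero, mul_eq_zero, HomeoPlus.preimage_Ioc, inv_inv] at this
        exact this.resolve_left fun h1 =>
          (ENNReal.ofReal_eq_zero.1 h1).not_gt (h.pos _ (h.inv_mem s hs))
  have hD : distributionFunction ν x₀ =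
      fun x => rightDistribution ν x - rightDistribution ν x₀ :=
    funext (distributionFunction_eq ν x₀)
  have hmono := monotone_rightDistribution ν
  have hcont := continuous_rightDistribution ν
  have hsurj : Function.Surjective (rightDistribution ν) := hcont.surjective
    (Filter.tendsto_atTop_atTop_of_monotone hmono fun b => by
      obtain ⟨_, ⟨x, rfl⟩, hx⟩ := not_bddAbove_iff.1 (h.not_bddAbove_rightDistribution hst hc h0) b
      exact ⟨x, hx.le⟩)
    (Filter.tendsto_atBot_atBot_of_monotone hmono fun b => by
      obtain ⟨_, ⟨x, rfl⟩, hx⟩ := not_bddBelow_iff.1 (h.not_bddBelow_rightDistribution hst hc h0) b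
      exact ⟨x, hx.le⟩)
  have hsurj' : Function.Surjective (distributionFunction ν x₀) := fun t => by
    obtain ⟨x, hx⟩ := hsurj (t + rightDistribution ν x₀)
    exact ⟨x, by rw [hD]; dsimp only; rw [hx, add_sub_cancel_right]⟩
  have hfib : ∀ g ∈ generatedGroup μ, ∀ x y, x ≤ y → rightDistribution ν x = rightDistribution ν y →
      rightDistribution ν (g x) = rightDistribution ν (g y) := by
    intro g hg x y hxy he
    have h1 := rightDistribution_sub ν hxy
    rw [he, sub_self, eq_comm, measureReal_eq_zero_iff measure_Ioc_lt_top.ne] at h1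
    have h2 := rightDistribution_sub ν (g.monotone hxy)
    rw [Measure.real, hnull g hg x y h1, ENNReal.toReal_zero] at h2
    linarith
  obtain ⟨ρ, hρ⟩ := exists_isSemiconjugacy (G := generatedGroup μ)
    (D := distributionFunction ν x₀) (hD ▸ hcont.sub continuous_const)
    (fun x y hxy => by simpa [hD] using hmono hxy) hsurj' (fun g hg x y he => by
      simp only [hD, sub_left_inj] at he ⊢
      rcases le_total x y with hxy | hxy
      · exact hfib g hg x y hxy he
      · exact (hfib g hg y x hxy he.symm).symm)
  refine ⟨ρ, hρ, fun t => ?_⟩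
  classical
  -- Surjectivity lets the identity be checked at values of D, where equivariance turns it into
  -- harmonicity of D at x.
  obtain ⟨x, rfl⟩ := hsurj' t
  have key := PMF.hasSum_map_toReal_mul (onGeneratedGroup μ) ρ.rangeRestrict
    (fun k => (k : HomeoPlus) (distributionFunction ν x₀ x))
    (hfin.toFinset.subtype (· ∈ generatedGroup μ)) (fun a ha => by
      have : μ (a : HomeoPlus) = 0 := by simpa using ha
      exact this)
  have e : ∑ a ∈ hfin.toFinset.subtype (· ∈ generatedGroup μ), (onGeneratedGroup μ a).toReal *
      ((ρ.rangeRestrict a : ρ.range) : HomeoPlus) (distributionFunction ν x₀ x) =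
      distributionFunction ν x₀ x := by
    rw [Finset.sum_congr rfl fun a _ => show (onGeneratedGroup μ a).toReal *
      ((ρ.rangeRestrict a : ρ.range) : HomeoPlus) (distributionFunction ν x₀ x) =
      (μ (a : HomeoPlus)).toReal * distributionFunction ν x₀ ((a : HomeoPlus) x) by
        rw [hρ.equivariant]; rfl]
    rw [Finset.sum_subtype_of_mem (fun s : HomeoPlus =>
      (μ s).toReal * distributionFunction ν x₀ (s x)) hmemG]
    simp only [hD, mul_sub, Finset.sum_sub_distrib]
    rw [h.sum_weight_mul_const, h.isHarmonicAt_rightDistribution hst h0 x]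
  rw [e] at key
  exact key
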